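/- **Setting.** Fix a design $x_1,\dots,x_N\in\mathbb{R}^p$ ($N\ge 1$), where $x_i=\mathbf X_i^{(I)}$ is the $i$-th covariate vector with the features in $I\subseteq\{1,\dots,p\}$ replaced by constants (their marginal means), and let $Y_i=f_{0,-I}(x_i)+w_i$ with independent zero-mean noise satisfying $\mathbb{E}e^{s w_i}\le e^{s^2\sigma^2/2}$ for all $s\in\mathbb{R}$, $\sigma>0$, and $|Y_i|\le B$ almost surely. Write $\|h\|_N^2=\frac1N\sum_i h(x_i)^2$. **Trees and kernel.** Each feature $j$ has thresholds $t_{j,1},\dots,t_{j,n}$; a split $(j,k)$ asks whether $x_j>t_{j,k}$, and $S$ is the set of the $pn$ splits. A symmetric oblivious tree of depth $d$ is a set $\nu\subseteq S$ with $|\nu|=\min(d,pn)$; $\mathcal V$ is the set of these trees. A set $\nu\subseteq S$ of splits has $2^{|\nu|}$ leaves, indexed by the answers to the splits in $\nu$, with indicators $\phi_\nu^{(j)}$ and counts $N_\nu^{(j)}=\sum_i\phi_\nu^{(j)}(x_i)$. Let $\mathcal F$ be the span of all the $\phi^{(j)}_\nu$, $\nu\in\mathcal V$, and $$k_\nu(x,x')=\sum_j\frac{N}{\max\{N_\nu^{(j)},1\}}\phi_\nu^{(j)}(x)\phi_\nu^{(j)}(x'),\qquad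 \mathbb K=\frac1{|\mathcal V|}\sum_{\nu\in\mathcal V}k_\nu .$$ Let $\mathcal H$ be the RKHS of $\mathbb K$, $K=\big(\tfrac1N\mathbb K(x_i,x_j)\big)_{i,j}$ with eigenvalues $\hat\lambda_1,\dots,\hat\lambda_N$, and $\widehat{\mathcal R}_K(\varrho)=\big[\tfrac1N\sum_i\min\{\hat\lambda_i,\varrho^2\}\big]^{1/2}$. **Algorithm.** For residuals $z\in\mathbb{R}^N$ put $D(\nu,z)=\frac1N\sum_j(\sum_i\phi_\nu^{(j)}(x_i)z_i)^2/N_\nu^{(j)}$, the sum being over the leaves with $N_\nu^{(j)}>0$. SampleTree starts from the empty set and, $\min(d,pn)$ times, adds to the current set $\nu$ the unused split $s$ that maximizes $D(\nu\cup\{s\},z)-\beta\log(-\log u(s))$, with fresh independent $u(s)\sim U[0,1]$. Starting from a warm start $f_0=f_N^c$, iterate $f_{\tau+1}=f_\tau+\epsilon\sum_j\theta_j\phi_{\nu_\tau}^{(j)}$, where $z_\tau=Y-f_\tau(x_{1:N})$, $\nu_\tau=\mathrm{SampleTree}(z_\tau)$, and $\theta_j$ is the mean of $z_\tau$ over the design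 points in leaf $j$ ($0$ for an empty leaf). The warm start $f_N^c$ may depend on the data and on independent algorithmic randomness of its own training; $\mathbb E_u$ averages over that randomness and over the seeds $u$ of the run, the data being held fixed. **Assumptions.** $f_{0,-I}\in\mathcal H$ and $f_N^c\in\mathcal H$ ($f_N^c$ integrable over its training randomness); $\|Y-f_N^c(x_{1:N})\|_2\le C_0\sqrt N$ almost surely; $C_{\mathcal H}:=\|\mathbb E_u f_N^c-f_{0,-I}\|_{\mathcal H}$ satisfies $0<a\le C_{\mathcal H}\le A$ almost surely. **Stopping.** Put $\eta_\tau=\tau\epsilon$; let $\hat\varrho_N$ be the smallest $\varrho>0$ with $\widehat{\mathcal R}_K(\varrho)\le\varrho^2C_{\mathcal H}^2/(2e\sigma)$, and let $$\widehat T_{\max}=\min\Big\{\tau\ge1:\widehat{\mathcal R}_K(1/\sqrt{\eta_\tau})>\frac{C_{\mathcal H}^2}{2e\sigma\eta_\tau}\Big\}-1 .$$ Let $f_*\in\mathcal F$ minimize $\frac1{2N}\|Y-f(x_{1:N})\|_2^2$ over $\mathcal F$, $R=\|f_*(x_{1:N})\|_2$, $M_\beta=e^{dR^2/(N\beta)}$,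 and $$g(\tau)=\frac{4\epsilon^2}{N}\,(2R+C_0\sqrt N)^2(M_\beta-1)^2\left(\frac{1-e^{-\tau\epsilon/(2M_\beta N)}}{1-e^{-\epsilon/(2M_\beta N)}}\right)^2 .$$ For a constant $C>0$, let $\widehat T_{op}$ be any minimizer of $C/\eta_\tau+g(\tau)$ over $0\le\tau\le\widehat T_{\max}$ (with $C/\eta_0=+\infty$). **Statement.** There are universal constants $c_3,c_4>0$ such that for all $\sigma,a,A,B,C_0,C$ as above there is a constant $c>0$, depending on these six numbers only, with the following property. For all $N\ge1$, $p,n,d\ge 0$, thresholds, designs, data and warm starts as above, all $\beta\ge N^{5/4}$ and every deterministic $\epsilon>0$ with $\epsilon\le\frac1{4M_\beta N}$ almost surely, with probability at least $1-c_3\,\mathbb E\big[\exp(-c_4N\hat\varrho_N^2)\big]$ (the expectation is superfluous if $C_{\mathcal H}$, and hence $\hat\varrho_N$, is not random) $$\big\|\mathbb E_u f_{\widehat T_{op}}-f_{0,-I}\big\|_N^2\le c\,\sqrt{\frac{2^d}{N}} .$$ -/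

import Mathlib

open MeasureTheory ProbabilityTheory
open scoped NNReal ENNReal

namespace GBDT

noncomputable section

/-! ### Data -/

/-- A point of the feature space `ℝ^p` (only coordinates are used, never a norm). -/
abbrev Point (p : ℕ) := Fin p → ℝ

/-- Drop the features in `I`, replacing the `j`-th one by the constant `m j`
(its marginal mean). -/
def dropFeatures {p : ℕ} (I : Finset (Fin p)) (m : Point p) (x : Point p) : Point p :=
  fun j => if j ∈ I then m j else x j

/-- The squared empirical norm `‖h‖_N² = (1/N) ∑ h(X_i)²`. -/
def empNormSq {N p : ℕ} (X : Fin N → Point p) (h : Point p → ℝ) : ℝ :=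
  (1 / (N : ℝ)) * ∑ i, (h (X i)) ^ 2

/-- The empirical loss `L(f) = (1/(2N)) ‖Y - f(X)‖²`. -/
def loss {N p : ℕ} (X : Fin N → Point p) (Y : Fin N → ℝ) (f : Point p → ℝ) : ℝ :=
  (1 / (2 * (N : ℝ))) * ∑ i, (Y i - f (X i)) ^ 2

/-! ### Symmetric (oblivious) trees -/

/-- A split `(j, k)`: compare feature `j` with its `k`-th threshold. -/
abbrev Split (p n : ℕ) := Fin p × Fin n

/-- In the oblivious tree using the splits `ν`, the leaf of `x` is determined by the answers to
all the splits; it is encoded by the set of splits answered affirmatively. The `2 ^ |ν|` leaves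
of the tree are the subsets of `ν`. -/
def leafOf {p n : ℕ} (t : Fin p → Fin n → ℝ) (ν : Finset (Split p n)) (x : Point p) :
    Finset (Split p n) :=
  open Classical in ν.filter (fun s => t s.1 s.2 < x s.1)

/-- Indicator `φ_ν^{(j)}` of the leaf `j` of the tree `ν`. -/
def leafInd {p n : ℕ} (t : Fin p → Fin n → ℝ) (ν j : Finset (Split p n)) (x : Point p) : ℝ :=
  if leafOf t ν x = j then 1 else 0

/-- Number `N_ν^{(j)}` of design points in the leaf `j` of the tree `ν`. -/
def leafCount {N p n : ℕ} (t : Fin p → Fin n → ℝ) (X : Fin N → Point p)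
    (ν j : Finset (Split p n)) : ℝ :=
  ∑ i, leafInd t ν j (X i)

/-- Score `D(ν, z)` of the tree `ν` for the residuals `z`
(empty leaves contribute `0 ^ 2 / 0 = 0`). -/
def score {N p n : ℕ} (t : Fin p → Fin n → ℝ) (X : Fin N → Point p)
    (ν : Finset (Split p n)) (z : Fin N → ℝ) : ℝ :=
  (1 / (N : ℝ)) *
    ∑ j ∈ ν.powerset, (∑ i, leafInd t ν j (X i) * z i) ^ 2 / leafCount t X ν j

/-- The weak learner with tree `ν` whose leaf values are the means of the residuals `z` in the
leaves (the value of a leaf without design points is `0 / 0 = 0`). -/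
def weakLearner {N p n : ℕ} (t : Fin p → Fin n → ℝ) (X : Fin N → Point p)
    (ν : Finset (Split p n)) (z : Fin N → ℝ) (x : Point p) : ℝ :=
  ∑ j ∈ ν.powerset,
    leafInd t ν j x * ((∑ i, leafInd t ν j (X i) * z i) / leafCount t X ν j)

/-- The set `𝒱` of all tree structures of depth `d` (all the splits are used when there are
fewer than `d`). -/
def treeStructures (p n d : ℕ) : Finset (Finset (Split p n)) :=
  (Finset.univ : Finset (Split p n)).powersetCard (min d (Fintype.card (Split p n)))

/-- The space `ℱ` of all ensembles of trees from `𝒱`. -/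
def ensembles {p n : ℕ} (t : Fin p → Fin n → ℝ) (d : ℕ) : Submodule ℝ (Point p → ℝ) :=
  Submodule.span ℝ {f | ∃ ν ∈ treeStructures p n d, ∃ j ∈ ν.powerset, f = leafInd t ν j}

/-- `f` is an empirical minimizer: it minimizes the empirical loss over `ℱ`. -/
def IsEmpiricalMinimizer {N p n : ℕ} (t : Fin p → Fin n → ℝ) (d : ℕ) (X : Fin N → Point p)
    (Y : Fin N → ℝ) (f : Point p → ℝ) : Prop :=
  f ∈ ensembles t d ∧ ∀ g ∈ ensembles t d, loss X Y f ≤ loss X Y g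

/-! ### Kernels -/

/-- The kernel `k_ν` of a single tree. -/
def treeKernel {N p n : ℕ} (t : Fin p → Fin n → ℝ) (X : Fin N → Point p)
    (ν : Finset (Split p n)) (x y : Point p) : ℝ :=
  ∑ j ∈ ν.powerset,
    ((N : ℝ) / max (leafCount t X ν j) 1) * leafInd t ν j x * leafInd t ν j y

/-- The stationary kernel: the average of `k_ν` under the uniform distribution on `𝒱`. -/
def stationaryKernel {N p n : ℕ} (t : Fin p → Fin n → ℝ) (d : ℕ) (X : Fin N → Point p)
    (x y : Point p) : ℝ :=
  ∑ ν ∈ treeStructures p n d, treeKernel t X ν x y * (1 / ((treeStructures p n d).card : ℝ))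

/-- The empirical kernel matrix of the stationary kernel. -/
def empKernelMatrix {N p n : ℕ} (t : Fin p → Fin n → ℝ) (d : ℕ) (X : Fin N → Point p) :
    Matrix (Fin N) (Fin N) ℝ :=
  Matrix.of fun i j => (1 / (N : ℝ)) * stationaryKernel t d X (X i) (X j)

theorem empKernelMatrix_isHermitian {N p n : ℕ} (t : Fin p → Fin n → ℝ) (d : ℕ)
    (X : Fin N → Point p) : (empKernelMatrix t d X).IsHermitian := by
  ext i j
  simp only [empKernelMatrix, stationaryKernel, treeKernel, Matrix.conjTranspose_apply,
    Matrix.of_apply, star_trivial]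
  congr 1
  refine Finset.sum_congr rfl fun ν _ => ?_
  congr 1
  exact Finset.sum_congr rfl fun l _ => by ring

/-- The eigenvalues (with multiplicity) of the empirical kernel matrix. -/
def empEigenvalue {N p n : ℕ} (t : Fin p → Fin n → ℝ) (d : ℕ) (X : Fin N → Point p)
    (i : Fin N) : ℝ :=
  (empKernelMatrix_isHermitian t d X).eigenvalues i

/-- Local empirical Rademacher complexity. -/
def localRademacher {N p n : ℕ} (t : Fin p → Fin n → ℝ) (d : ℕ) (X : Fin N → Point p)
    (ρ : ℝ) : ℝ :=
  Real.sqrt ((1 / (N : ℝ)) * ∑ i, min (empEigenvalue t d X i) (ρ ^ 2))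

/-- Critical empirical radius: the smallest positive `ρ` with
`R(ρ) ≤ ρ² C_H² / (2 e σ)`. -/
def criticalRadius {N p n : ℕ} (t : Fin p → Fin n → ℝ) (d : ℕ) (X : Fin N → Point p)
    (σ CH : ℝ) : ℝ :=
  sInf {ρ : ℝ | 0 < ρ ∧
    localRademacher t d X ρ ≤ ρ ^ 2 * CH ^ 2 / (2 * Real.exp 1 * σ)}

/-! ### The boosting algorithm -/

/-- Uniform random numbers used by the algorithm: `u τ i s` is attached to the candidate split `s`
at level `i` of the tree that is sampled in iteration `τ`. -/
abbrev Seeds (p n : ℕ) := ℕ → ℕ → Split p n → unitInterval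

/-- The law of independent uniform seeds. -/
def seedLaw (p n : ℕ) : Measure (Seeds p n) :=
  Measure.infinitePi fun _ : ℕ => Measure.infinitePi fun _ : ℕ =>
    Measure.pi fun _ : Split p n => (volume : Measure unitInterval)

/-- The elements of `S` that maximize `q` over `S`. -/
def maximizers {p n : ℕ} (S : Finset (Split p n)) (q : Split p n → ℝ) : Finset (Split p n) :=
  open Classical in S.filter (fun s => ∀ s' ∈ S, q s' ≤ q s)

/-- The first levels of the tree that `SampleTree` grows: at each level the candidate split with
the largest noisy score `D((ν, s), z) - β log (-log u)` is added, as long as a candidate is left.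
The tree of depth `d` is the value at `d`. -/
def sampleTree {N p n : ℕ} (t : Fin p → Fin n → ℝ) (X : Fin N → Point p) (β : ℝ)
    (z : Fin N → ℝ) (u : ℕ → Split p n → unitInterval) : ℕ → Finset (Split p n)
  | 0 => ∅
  | i + 1 =>
    let ν := sampleTree t X β z u i
    let M := maximizers (Finset.univ \ ν) fun s =>
      score t X (insert s ν) z - β * Real.log (-Real.log (u i s : ℝ))
    open Classical in if h : M.Nonempty then insert h.choose ν else ν

/-- The boosting iterates `f_τ`, started from `fc` and run on the data `(X, Y)` with learning
rate `ε`. -/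
def boost {N p n : ℕ} (t : Fin p → Fin n → ℝ) (d : ℕ) (X : Fin N → Point p) (Y : Fin N → ℝ)
    (β ε : ℝ) (fc : Point p → ℝ) (u : Seeds p n) : ℕ → Point p → ℝ
  | 0 => fc
  | τ + 1 => fun x =>
    let z : Fin N → ℝ := fun i => Y i - boost t d X Y β ε fc u τ (X i)
    boost t d X Y β ε fc u τ x
      + ε * weakLearner t X (sampleTree t X β z (u τ) d) z x

/-- The averaged iterate `E_u f_τ`. The randomness of the algorithm consists of the randomness
`v ∼ P` of the training of the full model `fc v`, from which the run is started, and of the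
independent uniform seeds `u` of the run. -/
def meanBoost {N p n : ℕ} {V : Type*} [MeasurableSpace V] (P : Measure V)
    (t : Fin p → Fin n → ℝ) (d : ℕ) (X : Fin N → Point p) (Y : Fin N → ℝ)
    (β ε : ℝ) (fc : V → Point p → ℝ) (τ : ℕ) (x : Point p) : ℝ :=
  ∫ q : V × Seeds p n, boost t d X Y β ε (fc q.1) q.2 τ x ∂(P.prod (seedLaw p n))

/-! ### Stopping times -/

/-- The norm `R = ‖f(X)‖₂` of the vector of values on the design. -/
def designNorm {N p : ℕ} (X : Fin N → Point p) (f : Point p → ℝ) : ℝ :=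
  Real.sqrt (∑ i, (f (X i)) ^ 2)

/-- `M_β = exp (d ‖f_*(X)‖₂² / (N β))`. -/
def Mβ {N p : ℕ} (d : ℕ) (X : Fin N → Point p) (β : ℝ) (fstar : Point p → ℝ) : ℝ :=
  Real.exp ((d : ℝ) * designNorm X fstar ^ 2 / ((N : ℝ) * β))

/-- The stopping threshold
`T_max = min {τ | R(1 / √η_τ) > C_H² / (2 e σ η_τ)} - 1`, where `η_τ = τ ε`. -/
def Tmax {N p n : ℕ} (t : Fin p → Fin n → ℝ) (d : ℕ) (X : Fin N → Point p)
    (σ CH ε : ℝ) : ℕ :=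
  sInf {τ : ℕ | 1 ≤ τ ∧
    CH ^ 2 / (2 * Real.exp 1 * σ * (τ * ε)) < localRademacher t d X (1 / Real.sqrt (τ * ε))} - 1

/-- The nondecreasing function `g` that controls the effect of the evolving kernel, where
`‖f_*(X)‖₂ = R` and the dropout error is at most `C₀ √N`. -/
def driftBound (N : ℕ) (ε M R C₀ : ℝ) (τ : ℕ) : ℝ :=
  4 * ε ^ 2 / N * (2 * R + C₀ * Real.sqrt N) ^ 2 * (M - 1) ^ 2 *
    ((1 - Real.exp (-(τ * ε / (2 * M * N)))) / (1 - Real.exp (-(ε / (2 * M * N))))) ^ 2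

/-- `C / η_τ + g(τ)`, with value `∞` at `τ = 0`. -/
def stopObjective (C ε : ℝ) (g : ℕ → ℝ) (τ : ℕ) : ℝ≥0∞ :=
  ENNReal.ofReal C / ENNReal.ofReal (τ * ε) + ENNReal.ofReal (g τ)

/-- `T` is an optimal stopping time: it minimizes `C / η_τ + g(τ)` over `τ ≤ T_max`. -/
def IsOptimalStop (C ε : ℝ) (g : ℕ → ℝ) (Tm T : ℕ) : Prop :=
  T ≤ Tm ∧ ∀ τ ≤ Tm, stopObjective C ε g T ≤ stopObjective C ε g τ

end

end GBDT

namespace GBDT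

/-! ### Tree projections on the design -/

section Projections

variable {N p n : ℕ} (t : Fin p → Fin n → ℝ) (X : Fin N → Point p)

/-! On the design, fitting leaf means is an orthogonal projection of the residuals, and the average
of these projections over all trees is the kernel matrix `K` (`avgProj_apply_eq_sum`). If trees were
drawn uniformly, the mean residual would evolve linearly, by `τ` applications of `I - εK`; write `S`
for this power. With `h = E fc - f₀` and noise `w`, the mean initial residual is `w - h(X)`, so the
error of the mean iterate on the design is exactly `(w - S w) + S h(X)` minus the deviation of the
true mean residual from its linear prediction (`empNormSq_meanBoost_sub_le`). Write `s = √(2^d /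
N)`, `η = τε` and `κ = 2eσ`; each of the three terms has square at most a constant times `s`.

Deviation. By the Gumbel trick a tree has probability at most `exp(dΔ/β)` times its uniform weight
(`treeSeedLaw_sampleTree_eq_le_card`), where `Δ = C₀²` bounds all scores because residuals never
grow. Since `I - εK` is a contraction, the one-step discrepancies only add up
(`norm_integral_resid_sub_le`), giving order `η d/β`. The horizon satisfies `η = O(N)`
(`le_of_le_Tmax`), and `β ≥ N^(5/4)` makes `(N d/β)²` of order `s` (`sq_mul_depth_div_le`).

Bias. Membership of `h` in the RKHS gives `‖S h(X)‖² / N ≤ ‖h‖² / η`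
(`norm_avgStep_pow_design_sq_le`). Optimality of the stopping time, compared with the endpoint
`Tmax`, bounds `1/η` by `1/η_max` plus the drift bound `g` there; both are of order `s`, because the
trace of `K` is at most `2^d` (`one_div_optimalStop_le`).

Noise. The stopping time is random but at most `Tmax` computed with `A` for `CH`, which is
deterministic. Up to that time the noise term is dominated by one quadratic form in `w` with fixed
weights `min(1, ηλ_k)`. A Gaussian linearization bounds its exponential moment
(`lintegral_exp_quadratic_le`), and the definition of `Tmax` bounds the sum of the weights. The form
exceeds a multiple of `N s` with probability at most `exp(-N κ s / a²)`, which is at most the mean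
of `exp(-N ρ̂²)` because `ρ̂² ≤ κ s / a²` (`criticalRadius_sq_le`).

If `s` is not small, a crude constant bound on the error suffices. -/

theorem leafInd_nonneg (ν j : Finset (Split p n)) (x : Point p) : 0 ≤ leafInd t ν j x := by
  unfold leafInd; split_ifs <;> norm_num

theorem sum_leafInd_mul (ν : Finset (Split p n)) (x : Point p)
    (c : Finset (Split p n) → ℝ) :
    ∑ j ∈ ν.powerset, leafInd t ν j x * c j = c (leafOf t ν x) := by
  classical
  rw [Finset.sum_eq_single (leafOf t ν x)]
  · simp [leafInd]
  · intro j _ hj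
    simp [leafInd, hj.symm]
  · intro h
    exact absurd (Finset.mem_powerset.2 (Finset.filter_subset _ _)) h

theorem weakLearner_eq (ν : Finset (Split p n)) (z : Fin N → ℝ) (x : Point p) :
    weakLearner t X ν z x =
      (∑ i, leafInd t ν (leafOf t ν x) (X i) * z i) / leafCount t X ν (leafOf t ν x) :=
  sum_leafInd_mul t ν x _

theorem leafCount_nonneg (ν j : Finset (Split p n)) : 0 ≤ leafCount t X ν j :=
  Finset.sum_nonneg fun _ _ => leafInd_nonneg t ν j _

theorem leafInd_eq_zero_of_leafCount {ν j : Finset (Split p n)} (h : leafCount t X ν j = 0)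
    (i : Fin N) : leafInd t ν j (X i) = 0 :=
  (Finset.sum_eq_zero_iff_of_nonneg fun _ _ => leafInd_nonneg t ν j _).1 h i (Finset.mem_univ i)

theorem one_le_leafCount {ν j : Finset (Split p n)} {i : Fin N} (h : leafInd t ν j (X i) ≠ 0) :
    1 ≤ leafCount t X ν j := by
  have h1 : leafInd t ν j (X i) = 1 := by
    unfold leafInd at h ⊢; split_ifs at h ⊢ <;> simp_all
  rw [← h1]
  exact Finset.single_le_sum (f := fun i => leafInd t ν j (X i))
    (fun _ _ => leafInd_nonneg t ν j _) (Finset.mem_univ i)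

/-- The kernel divides by `max(count, 1)` and the weak learner by the count. They differ only on
empty leaves, where the indicator vanishes at every design point. -/
theorem leafInd_div_max (ν j : Finset (Split p n)) (i : Fin N) :
    leafInd t ν j (X i) / max (leafCount t X ν j) 1 =
      leafInd t ν j (X i) / leafCount t X ν j := by
  by_cases h : leafInd t ν j (X i) = 0
  · simp [h]
  · rw [max_eq_left (one_le_leafCount t X h)]

/-- The fit of the weak learner on the design, as a linear map of the residuals. -/
noncomputable def leafProj (ν : Finset (Split p n)) :
    EuclideanSpace ℝ (Fin N) →L[ℝ] EuclideanSpace ℝ (Fin N) :=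
  LinearMap.toContinuousLinearMap
    { toFun := fun z => WithLp.toLp 2 fun i => weakLearner t X ν z (X i)
      map_add' := fun z w => by
        ext i
        simp [weakLearner_eq, mul_add, Finset.sum_add_distrib, add_div]
      map_smul' := fun c z => by
        ext i
        simp only [weakLearner_eq, PiLp.smul_apply, smul_eq_mul, RingHom.id_apply]
        rw [mul_div_assoc', Finset.mul_sum]
        congr 1
        exact Finset.sum_congr rfl fun _ _ => by ring }

@[simp]
theorem leafProj_apply (ν : Finset (Split p n)) (z : EuclideanSpace ℝ (Fin N)) (i : Fin N) :
    leafProj t X ν z i = weakLearner t X ν z (X i) := rfl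

theorem inner_leafProj (ν : Finset (Split p n)) (y z : EuclideanSpace ℝ (Fin N)) :
    inner ℝ y (leafProj t X ν z) = ∑ j ∈ ν.powerset,
      (∑ i, leafInd t ν j (X i) * y i) * (∑ i, leafInd t ν j (X i) * z i) /
        leafCount t X ν j := by
  simp only [PiLp.inner_apply, leafProj_apply, weakLearner, RCLike.inner_apply, conj_trivial,
    Finset.sum_mul]
  rw [Finset.sum_comm]
  refine Finset.sum_congr rfl fun j _ => ?_
  simp_rw [mul_right_comm _ _ (y.ofLp _)]
  rw [← Finset.sum_mul, ← Finset.sum_mul, mul_div_assoc]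

theorem inner_leafProj_comm (ν : Finset (Split p n)) (y z : EuclideanSpace ℝ (Fin N)) :
    inner ℝ y (leafProj t X ν z) = inner ℝ (leafProj t X ν y) z := by
  rw [real_inner_comm z, inner_leafProj, inner_leafProj]
  exact Finset.sum_congr rfl fun j _ => by ring

/-- Replacing residuals by leaf means preserves leaf sums. This is the idempotence which, with
symmetry, makes `leafProj` an orthogonal projection. -/
theorem sum_leafInd_mul_leafProj (ν j : Finset (Split p n)) (z : EuclideanSpace ℝ (Fin N)) :
    ∑ i, leafInd t ν j (X i) * leafProj t X ν z i = ∑ i, leafInd t ν j (X i) * z i := by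
  have h1 : ∀ i, leafInd t ν j (X i) * leafProj t X ν z i =
      leafInd t ν j (X i) * ((∑ i, leafInd t ν j (X i) * z i) / leafCount t X ν j) := by
    intro i
    rw [leafProj_apply, weakLearner_eq]
    by_cases h : leafOf t ν (X i) = j
    · rw [h]
    · simp [leafInd, h]
  simp_rw [h1]
  rw [← Finset.sum_mul]
  by_cases h : leafCount t X ν j = 0
  · simp [leafInd_eq_zero_of_leafCount t X h]
  · exact mul_div_cancel₀ _ h

theorem inner_leafProj_self (ν : Finset (Split p n)) (z : EuclideanSpace ℝ (Fin N)) :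
    inner ℝ z (leafProj t X ν z) = ‖leafProj t X ν z‖ ^ 2 := by
  rw [← real_inner_self_eq_norm_sq, inner_leafProj, inner_leafProj]
  simp_rw [sum_leafInd_mul_leafProj]

theorem norm_leafProj_le (ν : Finset (Split p n)) (z : EuclideanSpace ℝ (Fin N)) :
    ‖leafProj t X ν z‖ ≤ ‖z‖ := by
  have h1 := inner_leafProj_self t X ν z
  have h2 := real_inner_le_norm z (leafProj t X ν z)
  by_contra h
  push Not at h
  nlinarith [norm_nonneg z, norm_nonneg (leafProj t X ν z)]

/-- For an orthogonal projection the squared norm drops by `ε (2 - ε) ‖Pz‖²`. Hence residuals never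
grow along a run, whatever trees are drawn. -/
theorem norm_sub_smul_leafProj_le (ν : Finset (Split p n)) {ε : ℝ} (h0 : 0 ≤ ε) (h1 : ε ≤ 1)
    (z : EuclideanSpace ℝ (Fin N)) : ‖z - ε • leafProj t X ν z‖ ≤ ‖z‖ := by
  have h := norm_sub_sq_real z (ε • leafProj t X ν z)
  rw [inner_smul_right, inner_leafProj_self, norm_smul, Real.norm_of_nonneg h0] at h
  refine le_of_sq_le_sq ?_ (norm_nonneg _)
  rw [h]
  nlinarith [mul_nonneg (mul_nonneg h0 (by linarith : 0 ≤ 2 - ε))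
    (sq_nonneg ‖leafProj t X ν z‖)]

theorem score_eq (ν : Finset (Split p n)) (z : EuclideanSpace ℝ (Fin N)) :
    score t X ν z = (1 / (N : ℝ)) * ‖leafProj t X ν z‖ ^ 2 := by
  rw [← inner_leafProj_self, inner_leafProj, score]
  simp_rw [sq]

theorem score_nonneg (ν : Finset (Split p n)) (z : EuclideanSpace ℝ (Fin N)) :
    0 ≤ score t X ν z := by
  rw [score_eq]; positivity

theorem score_le (ν : Finset (Split p n)) (z : EuclideanSpace ℝ (Fin N)) :
    score t X ν z ≤ (1 / (N : ℝ)) * ‖z‖ ^ 2 := by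
  rw [score_eq]
  have := norm_leafProj_le t X ν z
  gcongr

variable (d : ℕ)

theorem card_treeStructures_pos : 0 < (treeStructures p n d).card := by
  rw [treeStructures, Finset.card_powersetCard]
  exact Nat.choose_pos (by simp)

/-- The average of the tree projections over all tree structures. -/
noncomputable def avgProj : EuclideanSpace ℝ (Fin N) →L[ℝ] EuclideanSpace ℝ (Fin N) :=
  (1 / ((treeStructures p n d).card : ℝ)) • ∑ ν ∈ treeStructures p n d, leafProj t X ν

theorem avgProj_apply (z : EuclideanSpace ℝ (Fin N)) :
    avgProj t X d z =
      ∑ ν ∈ treeStructures p n d, (1 / ((treeStructures p n d).card : ℝ)) • leafProj t X ν z := by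
  simp [avgProj, Finset.smul_sum]

theorem sum_weights : ∑ _ν ∈ treeStructures p n d, (1 / ((treeStructures p n d).card : ℝ)) = 1 := by
  have : ((treeStructures p n d).card : ℝ) ≠ 0 := by
    exact_mod_cast (card_treeStructures_pos d).ne'
  simp [this]

theorem inner_avgProj_comm (y z : EuclideanSpace ℝ (Fin N)) :
    inner ℝ y (avgProj t X d z) = inner ℝ (avgProj t X d y) z := by
  simp only [avgProj_apply, inner_sum, sum_inner, inner_smul_left, inner_smul_right,
    inner_leafProj_comm, conj_trivial]

theorem inner_avgProj_self_nonneg (z : EuclideanSpace ℝ (Fin N)) :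
    0 ≤ inner ℝ z (avgProj t X d z) := by
  simp only [avgProj_apply, inner_sum, inner_smul_right, inner_leafProj_self]
  positivity

theorem norm_avgProj_le (z : EuclideanSpace ℝ (Fin N)) : ‖avgProj t X d z‖ ≤ ‖z‖ := by
  rw [avgProj_apply]
  calc _ ≤ ∑ ν ∈ treeStructures p n d, (1 / ((treeStructures p n d).card : ℝ)) * ‖z‖ := by
        refine norm_sum_le_of_le _ fun ν _ => ?_
        rw [norm_smul, Real.norm_of_nonneg (by positivity)]
        gcongr
        exact norm_leafProj_le t X ν z
    _ = ‖z‖ := by rw [← Finset.sum_mul, sum_weights, one_mul]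

theorem norm_sub_smul_avgProj_le {ε : ℝ} (h0 : 0 ≤ ε) (h1 : ε ≤ 1)
    (z : EuclideanSpace ℝ (Fin N)) : ‖z - ε • avgProj t X d z‖ ≤ ‖z‖ := by
  have : z - ε • avgProj t X d z = ∑ ν ∈ treeStructures p n d,
      (1 / ((treeStructures p n d).card : ℝ)) • (z - ε • leafProj t X ν z) := by
    simp_rw [smul_sub]
    rw [Finset.sum_sub_distrib, ← Finset.sum_smul, sum_weights, one_smul, avgProj_apply,
      Finset.smul_sum]
    congr 1
    exact Finset.sum_congr rfl fun ν _ => smul_comm _ _ _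
  rw [this]
  calc _ ≤ ∑ ν ∈ treeStructures p n d, (1 / ((treeStructures p n d).card : ℝ)) * ‖z‖ := by
        refine norm_sum_le_of_le _ fun ν _ => ?_
        rw [norm_smul, Real.norm_of_nonneg (by positivity)]
        gcongr
        exact norm_sub_smul_leafProj_le t X ν h0 h1 z
    _ = ‖z‖ := by rw [← Finset.sum_mul, sum_weights, one_mul]

/-- The bridge between the algorithm and the kernel: the spectrum of the averaged step is that of
the empirical kernel matrix. -/
theorem avgProj_apply_eq_sum (hN : N ≠ 0) (z : EuclideanSpace ℝ (Fin N)) (i : Fin N) :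
    avgProj t X d z i = ∑ l, empKernelMatrix t d X i l * z l := by
  have hN' : (N : ℝ) ≠ 0 := by exact_mod_cast hN
  simp only [avgProj_apply, WithLp.ofLp_sum, Finset.sum_apply, PiLp.smul_apply, leafProj_apply,
    smul_eq_mul, empKernelMatrix, Matrix.of_apply, stationaryKernel, treeKernel, weakLearner,
    Finset.mul_sum, Finset.sum_mul, Finset.sum_div]
  refine Eq.trans ?_ Finset.sum_comm
  refine Finset.sum_congr rfl fun ν _ => ?_
  rw [Finset.sum_comm]
  refine Finset.sum_congr rfl fun l _ => Finset.sum_congr rfl fun j _ => ?_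
  have := leafInd_div_max t X ν j i
  rw [div_eq_mul_inv, div_eq_mul_inv] at this
  calc _ = 1 / ((treeStructures p n d).card : ℝ) * (leafInd t ν j (X l) * z.ofLp l) *
        (leafInd t ν j (X i) * (leafCount t X ν j)⁻¹) := by
          rw [div_eq_mul_inv _ (leafCount t X ν j)]; ring
    _ = _ := by
      rw [← this]
      field_simp

/-! ### Spectrum of the kernel matrix -/

/-- The orthonormal eigenbasis of the empirical kernel matrix. -/
noncomputable def kernelBasis : OrthonormalBasis (Fin N) ℝ (EuclideanSpace ℝ (Fin N)) :=
  (empKernelMatrix_isHermitian t d X).eigenvectorBasis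

theorem avgProj_kernelBasis (hN : N ≠ 0) (k : Fin N) :
    avgProj t X d (kernelBasis t X d k) = empEigenvalue t d X k • kernelBasis t X d k := by
  ext i
  rw [avgProj_apply_eq_sum t X d hN]
  exact congrFun ((empKernelMatrix_isHermitian t d X).mulVec_eigenvectorBasis k) i

theorem inner_kernelBasis_avgProj (hN : N ≠ 0) (k : Fin N) (z : EuclideanSpace ℝ (Fin N)) :
    inner ℝ (kernelBasis t X d k) (avgProj t X d z) =
      empEigenvalue t d X k * inner ℝ (kernelBasis t X d k) z := by
  rw [inner_avgProj_comm, avgProj_kernelBasis t X d hN, inner_smul_left, conj_trivial]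

theorem empEigenvalue_eq (hN : N ≠ 0) (k : Fin N) : empEigenvalue t d X k =
    inner ℝ (kernelBasis t X d k) (avgProj t X d (kernelBasis t X d k)) := by
  rw [inner_kernelBasis_avgProj t X d hN, real_inner_self_eq_norm_sq,
    (kernelBasis t X d).norm_eq_one]
  norm_num

theorem empEigenvalue_nonneg (hN : N ≠ 0) (k : Fin N) : 0 ≤ empEigenvalue t d X k := by
  rw [empEigenvalue_eq t X d hN]
  exact inner_avgProj_self_nonneg t X d _

theorem empEigenvalue_le_one (hN : N ≠ 0) (k : Fin N) : empEigenvalue t d X k ≤ 1 := by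
  rw [empEigenvalue_eq t X d hN]
  have h1 := real_inner_le_norm (kernelBasis t X d k) (avgProj t X d (kernelBasis t X d k))
  have h2 := norm_avgProj_le t X d (kernelBasis t X d k)
  rw [(kernelBasis t X d).norm_eq_one] at h1 h2
  linarith

theorem norm_sq_eq_sum_kernelBasis (z : EuclideanSpace ℝ (Fin N)) :
    ‖z‖ ^ 2 = ∑ k, inner ℝ (kernelBasis t X d k) z ^ 2 := by
  rw [← (kernelBasis t X d).sum_sq_norm_inner_right z]
  simp

/-- The trace of the kernel matrix is the average number of nonempty leaves: each leaf contributes 1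
or 0 according to whether it holds a design point. -/
theorem sum_empEigenvalue (hN : N ≠ 0) : ∑ k, empEigenvalue t d X k =
    ∑ ν ∈ treeStructures p n d, (1 / ((treeStructures p n d).card : ℝ)) *
      ∑ j ∈ ν.powerset, leafCount t X ν j / max (leafCount t X ν j) 1 := by
  have hN' : (N : ℝ) ≠ 0 := by exact_mod_cast hN
  have h := (empKernelMatrix_isHermitian t d X).trace_eq_sum_eigenvalues
  simp only [RCLike.ofReal_real_eq_id, id_eq] at h
  unfold empEigenvalue
  rw [← h]
  simp only [Matrix.trace, Matrix.diag_apply, empKernelMatrix, Matrix.of_apply, stationaryKernel,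
    treeKernel, Finset.mul_sum, Finset.sum_mul]
  rw [Finset.sum_comm]
  refine Finset.sum_congr rfl fun ν _ => ?_
  rw [Finset.sum_comm]
  refine Finset.sum_congr rfl fun j _ => ?_
  rw [leafCount, Finset.sum_div, Finset.mul_sum]
  refine Finset.sum_congr rfl fun i _ => ?_
  have : leafInd t ν j (X i) * leafInd t ν j (X i) = leafInd t ν j (X i) := by
    unfold leafInd; split_ifs <;> simp
  nth_rewrite 3 [← this]
  field_simp

theorem sum_empEigenvalue_le (hN : N ≠ 0) : ∑ k, empEigenvalue t d X k ≤ 2 ^ d := by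
  rw [sum_empEigenvalue t X d hN]
  calc _ ≤ ∑ ν ∈ treeStructures p n d, (1 / ((treeStructures p n d).card : ℝ)) * 2 ^ d := by
        refine Finset.sum_le_sum fun ν hν => ?_
        gcongr
        calc _ ≤ ∑ j ∈ ν.powerset, (1 : ℝ) := by
              refine Finset.sum_le_sum fun j _ => ?_
              exact div_le_one_of_le₀ (le_max_left _ _) (by positivity)
          _ = 2 ^ ν.card := by simp
          _ ≤ 2 ^ d := by
              refine pow_le_pow_right₀ one_le_two ?_
              rw [treeStructures, Finset.mem_powersetCard] at hν
              omega
    _ = 2 ^ d := by rw [← Finset.sum_mul, sum_weights, one_mul]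

/-- In every tree the leaf of the first design point is nonempty. This lower bound is what later
makes the stopping threshold finite and of order `N`. -/
theorem one_le_sum_empEigenvalue (hN : N ≠ 0) : 1 ≤ ∑ k, empEigenvalue t d X k := by
  rw [sum_empEigenvalue t X d hN]
  refine (sum_weights (p := p) (n := n) d).ge.trans ?_
  refine Finset.sum_le_sum fun ν _ => le_mul_of_one_le_right (one_div_nonneg.2 (Nat.cast_nonneg _)) ?_
  let i : Fin N := ⟨0, Nat.pos_of_ne_zero hN⟩
  have h1 : 1 ≤ leafCount t X ν (leafOf t ν (X i)) :=
    one_le_leafCount t X (i := i) (by simp [leafInd])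
  have hmem : leafOf t ν (X i) ∈ ν.powerset :=
    Finset.mem_powerset.2 (Finset.filter_subset _ _)
  refine le_trans ?_ (Finset.single_le_sum (fun j _ => ?_) hmem)
  · rw [max_eq_left h1, div_self (by linarith)]
  · exact div_nonneg (leafCount_nonneg t X ν j) (by positivity)

end Projections

/-! ### Resampling one coordinate of a product measure -/

section Update

variable {ι : Type*} [DecidableEq ι] {E : ι → Type*} [∀ i, MeasurableSpace (E i)]

/-- The form in which independence of the seeds is used: one coordinate can be redrawn and
integrated out separately. Equality of the laws is checked on finite boxes. -/
theorem measurePreserving_update (μ : ∀ i, Measure (E i)) [∀ i, IsProbabilityMeasure (μ i)]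
    (i : ι) :
    MeasurePreserving (fun q : (∀ j, E j) × E i => Function.update q.1 i q.2)
      ((Measure.infinitePi μ).prod (μ i)) (Measure.infinitePi μ) := by
  have hmeas : Measurable fun q : (∀ j, E j) × E i => Function.update q.1 i q.2 := by
    refine measurable_pi_lambda _ fun j => ?_
    by_cases h : j = i
    · subst h; simpa using measurable_snd
    · simp only [Function.update_of_ne h]; fun_prop
  refine ⟨hmeas, Measure.eq_infinitePi μ fun s T hT => ?_⟩
  rw [Measure.map_apply hmeas (MeasurableSet.pi s.countable_toSet fun j _ => hT j)]
  have h : (fun q : (∀ j, E j) × E i => Function.update q.1 i q.2) ⁻¹' (Set.pi s T) =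
      (Set.pi (s.erase i : Finset ι) T) ×ˢ (if i ∈ s then T i else Set.univ) := by
    ext q
    simp only [Set.mem_preimage, Set.mem_pi, Set.mem_prod, Finset.mem_coe, Finset.mem_erase]
    constructor
    · intro h
      refine ⟨fun j hj => by simpa [hj.1] using h j hj.2, ?_⟩
      split_ifs with hi
      · simpa using h i hi
      · trivial
    · rintro ⟨h1, h2⟩ j hj
      by_cases h : j = i
      · subst h; simpa [hj] using h2
      · simpa [h] using h1 j ⟨h, hj⟩
  rw [h, Measure.prod_prod, Measure.infinitePi_pi μ fun j _ => hT j]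
  split_ifs with hi
  · rw [mul_comm, Finset.mul_prod_erase s (fun j => μ j (T j)) hi]
  · simp [Finset.erase_eq_of_notMem hi]

theorem infinitePi_inter_eval (μ : ∀ i, Measure (E i)) [∀ i, IsProbabilityMeasure (μ i)]
    (i : ι) {A : Set (∀ j, E j)} {B : Set (E i)} (hA : MeasurableSet A) (hB : MeasurableSet B)
    (hAi : ∀ u y, Function.update u i y ∈ A ↔ u ∈ A) :
    Measure.infinitePi μ {u | u ∈ A ∧ u i ∈ B} = Measure.infinitePi μ A * μ i B := by
  have hm : MeasurableSet {u : ∀ j, E j | u ∈ A ∧ u i ∈ B} :=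
    hA.inter (measurable_pi_apply i hB)
  rw [← (measurePreserving_update μ i).measure_preimage hm.nullMeasurableSet, ← Measure.prod_prod]
  congr 1
  ext q
  simp [hAi]

end Update

/-! ### The Gumbel trick -/

theorem lintegral_unitInterval_rpow {c : ℝ} (hc : 0 ≤ c) :
    ∫⁻ y : unitInterval, ENNReal.ofReal ((y : ℝ) ^ c) = ENNReal.ofReal (1 / (c + 1)) := by
  have h1 := lintegral_subtype_comap (μ := (volume : Measure ℝ)) (s := Set.Icc (0 : ℝ) 1)
    measurableSet_Icc fun y => ENNReal.ofReal (y ^ c)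
  have hint : IntervalIntegrable (fun y : ℝ => y ^ c) volume 0 1 :=
    intervalIntegral.intervalIntegrable_rpow (Or.inl hc)
  rw [intervalIntegrable_iff_integrableOn_Icc_of_le zero_le_one] at hint
  have h2 : ∫ y in Set.Icc (0 : ℝ) 1, y ^ c = 1 / (c + 1) := by
    rw [integral_Icc_eq_integral_Ioc, ← intervalIntegral.integral_of_le zero_le_one,
      integral_rpow (Or.inl (by linarith)), Real.one_rpow, Real.zero_rpow (by linarith), sub_zero]
  rw [← h2, ofReal_integral_eq_lintegral_ofReal hint]
  · exact h1
  · refine (ae_restrict_iff' measurableSet_Icc).2 (.of_forall fun y hy => ?_)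
    exact Real.rpow_nonneg hy.1 _

/-- Given `u s = y`, the other `|S| - 1` uniforms lie below `y ^ α` with probability `y ^ (α (|S| -
1))`; integrating over `y` gives the bound. -/
theorem pi_forall_le_rpow_le {ι : Type*} [Fintype ι] {S : Finset ι} {s : ι} (hs : s ∈ S)
    {α : ℝ} (hα : 0 ≤ α) :
    (Measure.pi fun _ : ι => (volume : Measure unitInterval))
      {u | ∀ s' ∈ S, s' ≠ s → (u s' : ℝ) ≤ (u s : ℝ) ^ α} ≤
      ENNReal.ofReal (1 / (((S.card : ℝ) - 1) * α + 1)) := by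
  classical
  have hm : MeasurableSet
      {u : ι → unitInterval | ∀ s' ∈ S, s' ≠ s → (u s' : ℝ) ≤ (u s : ℝ) ^ α} := by
    simp only [Set.ofPred_forall]
    refine Finset.measurableSet_biInter S fun s' _ => MeasurableSet.iInter fun _ => ?_
    exact measurableSet_le (by fun_prop) (by fun_prop)
  have hmp := measurePreserving_update (fun _ : ι => (volume : Measure unitInterval)) s
  rw [← Measure.infinitePi_eq_pi, ← hmp.measure_preimage hm.nullMeasurableSet,
    Measure.prod_apply_symm (hmp.measurable hm)]
  have hcard : 0 ≤ (S.card : ℝ) - 1 := by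
    have : 1 ≤ S.card := Finset.card_pos.2 ⟨s, hs⟩
    have : (1 : ℝ) ≤ S.card := by exact_mod_cast this
    linarith
  rw [← lintegral_unitInterval_rpow (mul_nonneg hcard hα)]
  refine lintegral_mono fun y => ?_
  have hy : (y : ℝ) ^ α ∈ Set.Icc (0 : ℝ) 1 :=
    ⟨Real.rpow_nonneg y.2.1 _, Real.rpow_le_one y.2.1 y.2.2 hα⟩
  have h : (fun u : ι → unitInterval => (u, y)) ⁻¹'
      ((fun q : (ι → unitInterval) × unitInterval => Function.update q.1 s q.2) ⁻¹'
        {u | ∀ s' ∈ S, s' ≠ s → (u s' : ℝ) ≤ (u s : ℝ) ^ α}) =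
      Set.pi (S.erase s : Finset ι) fun _ => Set.Iic (⟨(y : ℝ) ^ α, hy⟩ : unitInterval) := by
    ext u
    simp only [Set.mem_preimage, Set.mem_ofPred_eq, Function.update_self, Set.mem_pi,
      Finset.mem_coe, Finset.mem_erase, Set.mem_Iic]
    refine ⟨fun h s' hs' => ?_, fun h s' hs' hne => ?_⟩
    · have := h s' hs'.2 hs'.1
      rwa [Function.update_of_ne hs'.1] at this
    · rw [Function.update_of_ne hne]
      exact h s' ⟨hne, hs'⟩
  rw [h, Measure.infinitePi_pi _ fun _ _ => measurableSet_Iic]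
  simp only [unitInterval.volume_Iic, Finset.prod_const]
  rw [Finset.card_erase_of_mem hs, ← ENNReal.ofReal_pow hy.1, mul_comm, Real.rpow_mul y.2.1,
    ← Real.rpow_natCast, Nat.cast_sub (Finset.card_pos.2 ⟨s, hs⟩), Nat.cast_one]

theorem ae_mem_Ioo_unitInterval {ι : Type*} [Fintype ι] :
    ∀ᵐ u ∂(Measure.pi fun _ : ι => (volume : Measure unitInterval)),
      ∀ s, 0 < (u s : ℝ) ∧ (u s : ℝ) < 1 := by
  rw [ae_all_iff]
  intro s
  have h : ∀ᵐ y : unitInterval, 0 < (y : ℝ) ∧ (y : ℝ) < 1 := by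
    have h1 : (volume : Measure unitInterval) {0} = 0 := by simp
    have h2 : (volume : Measure unitInterval) {1} = 0 := by simp
    filter_upwards [measure_eq_zero_iff_ae_notMem.1 h1, measure_eq_zero_iff_ae_notMem.1 h2]
      with y hy0 hy1
    exact ⟨lt_of_le_of_ne y.2.1 fun h => hy0 (Subtype.ext h.symm),
      lt_of_le_of_ne y.2.2 fun h => hy1 (Subtype.ext h)⟩
  exact (measurePreserving_eval (fun _ : ι => (volume : Measure unitInterval))
    s).quasiMeasurePreserving.ae h

/-- The Gumbel trick. Scores differ by at most `Δ`, so `s` can win only if `e^(-Δ/β) (-log u s) ≤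
-log u s'` for every rival `s'`, that is, `u s' ≤ (u s) ^ α` with `α = e^(-Δ/β) ≤ 1`. The event is
that `s` is one of the maximizers, so ties need no separate treatment. -/
theorem pi_mem_maximizers_le {p n : ℕ} {S : Finset (Split p n)} {s : Split p n} (hs : s ∈ S)
    {D : Split p n → ℝ} {Δ β : ℝ} (hβ : 0 < β) (hD : ∀ s, 0 ≤ D s ∧ D s ≤ Δ) :
    (Measure.pi fun _ : Split p n => (volume : Measure unitInterval))
      {u | s ∈ maximizers S fun s => D s - β * Real.log (-Real.log (u s : ℝ))} ≤
      ENNReal.ofReal (Real.exp (Δ / β) / S.card) := by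
  have hcard : 1 ≤ (S.card : ℝ) := by
    have : 1 ≤ S.card := Finset.card_pos.2 ⟨s, hs⟩
    exact_mod_cast this
  have hΔ : 0 ≤ Δ := (hD s).1.trans (hD s).2
  have hα1 : Real.exp (-(Δ / β)) ≤ 1 := Real.exp_le_one_iff.2 (by simp; positivity)
  have hα0 := Real.exp_pos (-(Δ / β))
  calc
    _ ≤ (Measure.pi fun _ : Split p n => (volume : Measure unitInterval))
        {u | ∀ s' ∈ S, s' ≠ s → (u s' : ℝ) ≤ (u s : ℝ) ^ Real.exp (-(Δ / β))} := by
        refine measure_mono_ae ?_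
        -- At seeds 0 and 1 the logarithms take default values; this null set is discarded.
        filter_upwards [ae_mem_Ioo_unitInterval] with u hu hmem s' hs' _
        simp only [maximizers, Finset.mem_filter] at hmem
        have h1 := hmem.2 s' hs'
        have hE : ∀ s, 0 < -Real.log (u s : ℝ) := fun s =>
          neg_pos.2 (Real.log_neg (hu s).1 (hu s).2)
        have h2 : β * Real.log (-Real.log (u s : ℝ)) ≤
            Δ + β * Real.log (-Real.log (u s' : ℝ)) := by
          linarith [(hD s).2, (hD s').1]
        have h3 : -(Δ / β) + Real.log (-Real.log (u s : ℝ)) ≤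
            Real.log (-Real.log (u s' : ℝ)) := by
          rw [← mul_le_mul_iff_right₀ hβ, mul_add, mul_neg, mul_div_cancel₀ _ hβ.ne']
          linarith
        have h4 := Real.exp_le_exp.2 h3
        rw [Real.exp_add, Real.exp_log (hE s), Real.exp_log (hE s')] at h4
        rw [← Real.log_le_log_iff (hu s').1 (Real.rpow_pos_of_pos (hu s).1 _),
          Real.log_rpow (hu s).1]
        linarith
    _ ≤ _ := pi_forall_le_rpow_le hs hα0.le
    _ ≤ _ := by
        refine ENNReal.ofReal_le_ofReal ?_
        have : Real.exp (Δ / β) / S.card = 1 / (S.card * Real.exp (-(Δ / β))) := by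
          rw [Real.exp_neg]; field_simp
        rw [this]
        refine one_div_le_one_div_of_le (by positivity) ?_
        nlinarith

/-! ### The law of the sampled tree -/

section TreeLaw

variable {N p n : ℕ} (t : Fin p → Fin n → ℝ) (X : Fin N → Point p) (β : ℝ)

theorem maximizers_nonempty {S : Finset (Split p n)} (hS : S.Nonempty) (q : Split p n → ℝ) :
    (maximizers S q).Nonempty := by
  obtain ⟨s, hs, h⟩ := S.exists_max_image q hS
  exact ⟨s, by rw [maximizers, Finset.mem_filter]; exact ⟨hs, h⟩⟩

theorem maximizers_subset (S : Finset (Split p n)) (q : Split p n → ℝ) : maximizers S q ⊆ S :=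
  Finset.filter_subset _ _

/-- The noisy scores of the splits that may extend `ν`. -/
noncomputable def noisyScore (z : Fin N → ℝ) (ν : Finset (Split p n))
    (y : Split p n → unitInterval) (s : Split p n) : ℝ :=
  score t X (insert s ν) z - β * Real.log (-Real.log (y s : ℝ))

/-- Add a chosen element of `M` to `ν`. -/
noncomputable def extend (ν M : Finset (Split p n)) : Finset (Split p n) :=
  open Classical in if h : M.Nonempty then insert h.choose ν else ν

theorem sampleTree_succ (z : Fin N → ℝ) (u : ℕ → Split p n → unitInterval) (i : ℕ) :
    sampleTree t X β z u (i + 1) = extend (sampleTree t X β z u i)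
      (maximizers (Finset.univ \ sampleTree t X β z u i)
        (noisyScore t X β z (sampleTree t X β z u i) (u i))) := by
  simp only [sampleTree, extend]
  congr!

theorem exists_sampleTree_succ (z : Fin N → ℝ) (u : ℕ → Split p n → unitInterval) (i : ℕ)
    (h : sampleTree t X β z u i ≠ Finset.univ) :
    ∃ s ∈ maximizers (Finset.univ \ sampleTree t X β z u i)
        (noisyScore t X β z (sampleTree t X β z u i) (u i)),
      sampleTree t X β z u (i + 1) = insert s (sampleTree t X β z u i) := by
  have hM := maximizers_nonempty (S := Finset.univ \ sampleTree t X β z u i) (by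
    rw [Finset.sdiff_nonempty]
    exact fun h' => h (Finset.univ_subset_iff.1 h'))
    (noisyScore t X β z (sampleTree t X β z u i) (u i))
  refine ⟨hM.choose, hM.choose_spec, ?_⟩
  rw [sampleTree_succ, extend, dif_pos hM]

theorem sampleTree_succ_of_univ (z : Fin N → ℝ) (u : ℕ → Split p n → unitInterval) (i : ℕ)
    (h : sampleTree t X β z u i = Finset.univ) :
    sampleTree t X β z u (i + 1) = Finset.univ := by
  have : maximizers (Finset.univ \ sampleTree t X β z u i)
      (noisyScore t X β z (sampleTree t X β z u i) (u i)) = ∅ := by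
    rw [← Finset.subset_empty]
    refine (maximizers_subset _ _).trans ?_
    simp [h]
  rw [sampleTree_succ, this, extend, dif_neg (by simp), h]

theorem card_sampleTree (z : Fin N → ℝ) (u : ℕ → Split p n → unitInterval) (i : ℕ) :
    (sampleTree t X β z u i).card = min i (Fintype.card (Split p n)) := by
  induction i with
  | zero => simp [sampleTree]
  | succ i ih =>
    by_cases h : sampleTree t X β z u i = Finset.univ
    · rw [sampleTree_succ_of_univ t X β z u i h, Finset.card_univ]
      rw [h, Finset.card_univ] at ih
      omega
    · obtain ⟨s, hs, h'⟩ := exists_sampleTree_succ t X β z u i h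
      have hs' := maximizers_subset _ _ hs
      rw [h', Finset.card_insert_of_notMem (by simpa using hs'), ih]
      have hlt : (sampleTree t X β z u i).card < Fintype.card (Split p n) :=
        (Finset.card_lt_iff_ne_univ _).2 h
      omega

theorem sampleTree_mem_treeStructures (z : Fin N → ℝ) (u : ℕ → Split p n → unitInterval)
    (d : ℕ) : sampleTree t X β z u d ∈ treeStructures p n d := by
  rw [treeStructures, Finset.mem_powersetCard]
  exact ⟨Finset.subset_univ _, card_sampleTree t X β z u d⟩

theorem sampleTree_congr (z : Fin N → ℝ) {u u' : ℕ → Split p n → unitInterval} (i : ℕ)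
    (h : ∀ j < i, u j = u' j) : sampleTree t X β z u i = sampleTree t X β z u' i := by
  induction i with
  | zero => rfl
  | succ i ih =>
    rw [sampleTree_succ, sampleTree_succ, ih fun j hj => h j (hj.trans i.lt_succ_self),
      h i i.lt_succ_self]

variable {Q : Type*} [MeasurableSpace Q]

theorem measurable_score {z : Q → Fin N → ℝ} (hz : Measurable z) (ν : Finset (Split p n)) :
    Measurable fun q => score t X ν (z q) := by
  unfold score
  have : ∀ i, Measurable fun q => z q i := fun i => (measurable_pi_apply i).comp hz
  fun_prop

theorem measurable_noisyScore {z : Q → Fin N → ℝ} {y : Q → Split p n → unitInterval}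
    (hz : Measurable z) (hy : Measurable y) (ν : Finset (Split p n)) (s : Split p n) :
    Measurable fun q => noisyScore t X β (z q) ν (y q) s := by
  have h1 := measurable_score t X hz (insert s ν)
  have h2 : Measurable fun q => ((y q s : unitInterval) : ℝ) :=
    measurable_subtype_coe.comp ((measurable_pi_apply s).comp hy)
  unfold noisyScore
  exact h1.sub ((h2.log.neg.log).const_mul β)

theorem measurableSet_mem_maximizers {z : Q → Fin N → ℝ} {y : Q → Split p n → unitInterval}
    (hz : Measurable z) (hy : Measurable y) (ν S : Finset (Split p n)) (s : Split p n) :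
    MeasurableSet {q | s ∈ maximizers S (noisyScore t X β (z q) ν (y q))} := by
  have : {q | s ∈ maximizers S (noisyScore t X β (z q) ν (y q))} = {_q | s ∈ S} ∩
      ⋂ s' ∈ S, {q | noisyScore t X β (z q) ν (y q) s' ≤ noisyScore t X β (z q) ν (y q) s} := by
    ext q
    simp [maximizers]
  rw [this]
  refine (MeasurableSet.const _).inter ?_
  exact Finset.measurableSet_biInter S fun s' _ => measurableSet_le
    (measurable_noisyScore t X β hz hy ν s') (measurable_noisyScore t X β hz hy ν s)

theorem measurableSet_maximizers_eq {z : Q → Fin N → ℝ} {y : Q → Split p n → unitInterval}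
    (hz : Measurable z) (hy : Measurable y) (ν S M : Finset (Split p n)) :
    MeasurableSet {q | maximizers S (noisyScore t X β (z q) ν (y q)) = M} := by
  simp only [Finset.ext_iff, Set.ofPred_forall]
  refine MeasurableSet.iInter fun s => ?_
  by_cases hs : s ∈ M
  · simpa [hs] using measurableSet_mem_maximizers t X β hz hy ν S s
  · simp only [hs, iff_false]
    exact (measurableSet_mem_maximizers t X β hz hy ν S s).compl

/-- The next set is a fixed function `extend` of the current set and the set of maximizers, both
with finitely many values, so no measurable selection is needed. -/
theorem measurableSet_sampleTree_eq {z : Q → Fin N → ℝ}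
    {u : Q → ℕ → Split p n → unitInterval} (hz : Measurable z) (hu : Measurable u) (i : ℕ)
    (ν : Finset (Split p n)) : MeasurableSet {q | sampleTree t X β (z q) (u q) i = ν} := by
  induction i generalizing ν with
  | zero => exact MeasurableSet.const (∅ = ν)
  | succ i ih =>
    have : {q | sampleTree t X β (z q) (u q) (i + 1) = ν} =
        ⋃ ν' : Finset (Split p n), ⋃ M : Finset (Split p n),
          {q | sampleTree t X β (z q) (u q) i = ν'} ∩
          ({q | maximizers (Finset.univ \ ν') (noisyScore t X β (z q) ν' (u q i)) = M} ∩
            {_q | extend ν' M = ν}) := by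
      ext q
      simp [sampleTree_succ]
    rw [this]
    exact MeasurableSet.iUnion fun ν' => MeasurableSet.iUnion fun M => (ih ν').inter
      ((measurableSet_maximizers_eq t X β hz ((measurable_pi_apply i).comp hu) ν' _ M).inter
        (MeasurableSet.const _))

/-- The law of the seeds of a single tree. -/
noncomputable def treeSeedLaw (p n : ℕ) : Measure (ℕ → Split p n → unitInterval) :=
  Measure.infinitePi fun _ : ℕ => Measure.pi fun _ : Split p n => (volume : Measure unitInterval)

instance : IsProbabilityMeasure (treeSeedLaw p n) := by
  unfold treeSeedLaw; infer_instance

/-- A set `ν` of `i + 1` splits arises by adding some `s ∈ ν` last to `ν.erase s`, and the seeds of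
level `i` are independent of the earlier ones. Summing over the `i + 1` choices of `s` turns `1 /
(C(m, i) (m - i))` into `1 / C(m, i + 1)`, the uniform weight. -/
theorem treeSeedLaw_sampleTree_eq_le {β : ℝ} (hβ : 0 < β) {z : Fin N → ℝ} {Δ : ℝ}
    (hz : ∀ ν, 0 ≤ score t X ν z ∧ score t X ν z ≤ Δ) (i : ℕ)
    (hi : i ≤ Fintype.card (Split p n)) (ν : Finset (Split p n)) :
    treeSeedLaw p n {u | sampleTree t X β z u i = ν} ≤
      ENNReal.ofReal (Real.exp (i * (Δ / β)) / (Fintype.card (Split p n)).choose i) := by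
  induction i generalizing ν with
  | zero =>
    refine prob_le_one.trans ?_
    simp
  | succ i ih =>
    by_cases hν : ν.card = i + 1
    swap
    · have : {u : ℕ → Split p n → unitInterval | sampleTree t X β z u (i + 1) = ν} = ∅ := by
        refine Set.eq_empty_of_forall_notMem fun u hu => hν ?_
        have hu' : sampleTree t X β z u (i + 1) = ν := hu
        rw [← hu', card_sampleTree, min_eq_left hi]
      rw [this, measure_empty]
      exact zero_le
    set m := Fintype.card (Split p n) with hm
    have hsub : {u : ℕ → Split p n → unitInterval | sampleTree t X β z u (i + 1) = ν} ⊆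
        ⋃ s ∈ ν, {u | u ∈ {u | sampleTree t X β z u i = ν.erase s} ∧
          u i ∈ {y | s ∈ maximizers (Finset.univ \ ν.erase s)
            (noisyScore t X β z (ν.erase s) y)}} := by
      intro u hu
      have hu' : sampleTree t X β z u (i + 1) = ν := hu
      have hne : sampleTree t X β z u i ≠ Finset.univ := by
        intro h
        have := card_sampleTree t X β z u i
        rw [h, Finset.card_univ] at this
        omega
      obtain ⟨s, hs, h⟩ := exists_sampleTree_succ t X β z u i hne
      have hs' : s ∉ sampleTree t X β z u i := by
        simpa using maximizers_subset _ _ hs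
      rw [hu'] at h
      have he : ν.erase s = sampleTree t X β z u i := by
        rw [h, Finset.erase_insert hs']
      simp only [Set.mem_iUnion]
      refine ⟨s, h ▸ Finset.mem_insert_self _ _, he.symm, ?_⟩
      change s ∈ maximizers (Finset.univ \ ν.erase s) (noisyScore t X β z (ν.erase s) (u i))
      rw [he]
      exact hs
    have hbound : ∀ s ∈ ν, treeSeedLaw p n
        {u | u ∈ {u | sampleTree t X β z u i = ν.erase s} ∧
          u i ∈ {y | s ∈ maximizers (Finset.univ \ ν.erase s)
            (noisyScore t X β z (ν.erase s) y)}} ≤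
        ENNReal.ofReal (Real.exp (i * (Δ / β)) / m.choose i) *
          ENNReal.ofReal (Real.exp (Δ / β) / (m - i : ℕ)) := by
      intro s hs
      unfold treeSeedLaw
      rw [infinitePi_inter_eval]
      · refine mul_le_mul' (ih (by omega) _) ?_
        have hcard : (Finset.univ \ ν.erase s).card = m - i := by
          rw [Finset.card_sdiff_of_subset (Finset.subset_univ _), Finset.card_univ,
            Finset.card_erase_of_mem hs, hν, Nat.add_sub_cancel]
        rw [← hcard]
        exact pi_mem_maximizers_le (by simp) hβ fun s' => hz (insert s' (ν.erase s))
      · exact measurableSet_sampleTree_eq t X β measurable_const measurable_id i _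
      · exact measurableSet_mem_maximizers t X β measurable_const measurable_id _ _ _
      · intro u y
        simp only [Set.mem_ofPred_eq]
        rw [sampleTree_congr t X β z i fun j hj => Function.update_of_ne hj.ne y u]
    refine (measure_mono hsub).trans ((measure_biUnion_finset_le _ _).trans
      ((Finset.sum_le_sum hbound).trans ?_))
    rw [Finset.sum_const, hν, nsmul_eq_mul, ← ENNReal.ofReal_mul (by positivity),
      ← ENNReal.ofReal_natCast, ← ENNReal.ofReal_mul (by positivity)]
    refine ENNReal.ofReal_le_ofReal (le_of_eq ?_)
    have hc : (m.choose (i + 1) : ℝ) * (i + 1 : ℕ) = m.choose i * (m - i : ℕ) := by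
      exact_mod_cast Nat.choose_succ_right_eq m i
    have h1 : (m.choose (i + 1) : ℝ) ≠ 0 := by exact_mod_cast (Nat.choose_pos hi).ne'
    have h2 : (m.choose i : ℝ) ≠ 0 := by
      exact_mod_cast (Nat.choose_pos (by omega : i ≤ m)).ne'
    have h3 : ((m - i : ℕ) : ℝ) ≠ 0 := by
      have : 0 < m - i := by omega
      exact_mod_cast this.ne'
    have h4 : Real.exp (((i + 1 : ℕ) : ℝ) * (Δ / β)) =
        Real.exp (i * (Δ / β)) * Real.exp (Δ / β) := by
      rw [← Real.exp_add]; push_cast; ring_nf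
    rw [h4, div_mul_div_comm, ← hc]
    have h5 : ((i + 1 : ℕ) : ℝ) ≠ 0 := by positivity
    field_simp

theorem treeSeedLaw_sampleTree_eq_le_card {β : ℝ} (hβ : 0 < β) {z : Fin N → ℝ} {Δ : ℝ}
    (hz : ∀ ν, 0 ≤ score t X ν z ∧ score t X ν z ≤ Δ) (d : ℕ) (ν : Finset (Split p n)) :
    (treeSeedLaw p n).real {u | sampleTree t X β z u d = ν} ≤
      Real.exp (d * (Δ / β)) * (1 / ((treeStructures p n d).card : ℝ)) := by
  have hΔ : 0 ≤ Δ := (hz ∅).1.trans (hz ∅).2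
  refine ENNReal.toReal_le_of_le_ofReal (by positivity) ?_
  rw [mul_one_div, treeStructures, Finset.card_powersetCard, Finset.card_univ]
  rcases le_total d (Fintype.card (Split p n)) with h | h
  · rw [min_eq_left h]
    exact treeSeedLaw_sampleTree_eq_le t X hβ hz d h ν
  · rw [min_eq_right h, Nat.choose_self, Nat.cast_one, div_one]
    refine prob_le_one.trans (ENNReal.one_le_ofReal.2 (Real.one_le_exp (by positivity)))

end TreeLaw

/-! ### Residuals of the boosting iterates -/

section Residuals

variable {N p n : ℕ} (t : Fin p → Fin n → ℝ) (X : Fin N → Point p) (d : ℕ) (β ε : ℝ)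

/-- The residuals on the design of the boosting iterates, started from the residuals `z`. -/
noncomputable def resid (z : EuclideanSpace ℝ (Fin N)) (u : Seeds p n) :
    ℕ → EuclideanSpace ℝ (Fin N)
  | 0 => z
  | τ + 1 => resid z u τ - ε • leafProj t X (sampleTree t X β (resid z u τ) (u τ) d) (resid z u τ)

theorem boost_eq_sub_resid (Y : Fin N → ℝ) (fc : Point p → ℝ) (u : Seeds p n) (τ : ℕ)
    (i : Fin N) :
    boost t d X Y β ε fc u τ (X i) =
      Y i - resid t X d β ε (WithLp.toLp 2 fun i => Y i - fc (X i)) u τ i := by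
  induction τ generalizing i with
  | zero => simp [boost, resid]
  | succ τ ih =>
    have hz : (fun i => Y i - boost t d X Y β ε fc u τ (X i)) =
        ⇑(resid t X d β ε (WithLp.toLp 2 fun i => Y i - fc (X i)) u τ) := by
      ext i; rw [ih]; ring
    simp only [boost, resid]
    rw [hz, ih]
    simp only [PiLp.sub_apply, PiLp.smul_apply, leafProj_apply, smul_eq_mul]
    ring

theorem resid_congr (z : EuclideanSpace ℝ (Fin N)) {u u' : Seeds p n} (τ : ℕ)
    (h : ∀ j < τ, u j = u' j) : resid t X d β ε z u τ = resid t X d β ε z u' τ := by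
  induction τ with
  | zero => rfl
  | succ τ ih =>
    simp only [resid]
    rw [ih fun j hj => h j (hj.trans τ.lt_succ_self), h τ τ.lt_succ_self]

/-- Expresses the random projection through finitely many indicator events. The indicator on `Unit`
is a placeholder that agrees by unfolding with an indicator in whatever variable the seeds depend
on. -/
theorem leafProj_sampleTree_eq_sum (z : Fin N → ℝ) (r : EuclideanSpace ℝ (Fin N))
    (y : ℕ → Split p n → unitInterval) :
    leafProj t X (sampleTree t X β z y d) r = ∑ ν ∈ treeStructures p n d,
      Set.indicator {_q : Unit | sampleTree t X β z y d = ν} (fun _ => leafProj t X ν r) () := by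
  classical
  rw [Finset.sum_eq_single_of_mem _ (sampleTree_mem_treeStructures t X β z y d)]
  · simp
  · intro ν _ hν
    simp [hν.symm]

variable {Q : Type*} [MeasurableSpace Q]

theorem measurable_leafProj_sampleTree {r : Q → EuclideanSpace ℝ (Fin N)}
    {y : Q → ℕ → Split p n → unitInterval} (hr : Measurable r) (hy : Measurable y) :
    Measurable fun q => leafProj t X (sampleTree t X β (r q) (y q) d) (r q) := by
  simp_rw [leafProj_sampleTree_eq_sum]
  refine Finset.measurable_sum _ fun ν _ => ?_
  have hr' : Measurable fun q => (r q : Fin N → ℝ) := by fun_prop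
  exact Measurable.indicator (s := {q | sampleTree t X β (r q) (y q) d = ν})
    ((leafProj t X ν).continuous.measurable.comp hr)
    (measurableSet_sampleTree_eq t X β hr' hy d ν)

theorem measurable_resid {z : Q → EuclideanSpace ℝ (Fin N)} {u : Q → Seeds p n}
    (hz : Measurable z) (hu : Measurable u) (τ : ℕ) :
    Measurable fun q => resid t X d β ε (z q) (u q) τ := by
  induction τ with
  | zero => exact hz
  | succ τ ih =>
    simp only [resid]
    exact ih.sub ((measurable_leafProj_sampleTree t X d β ih
      ((measurable_pi_apply τ).comp hu)).const_smul ε)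

variable {ε}

theorem norm_resid_le (h0 : 0 ≤ ε) (h1 : ε ≤ 1) (z : EuclideanSpace ℝ (Fin N)) (u : Seeds p n)
    (τ : ℕ) : ‖resid t X d β ε z u τ‖ ≤ ‖z‖ := by
  induction τ with
  | zero => exact le_rfl
  | succ τ ih => exact (norm_sub_smul_leafProj_le t X _ h0 h1 _).trans ih

/-! ### Comparison with the stationary kernel -/

variable {β}

theorem norm_integral_leafProj_sampleTree_sub_le (hβ : 0 < β) {Δ : ℝ}
    (r : EuclideanSpace ℝ (Fin N)) (hr : (1 / (N : ℝ)) * ‖r‖ ^ 2 ≤ Δ) :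
    ‖(∫ y, leafProj t X (sampleTree t X β r y d) r ∂treeSeedLaw p n) - avgProj t X d r‖ ≤
      2 * (Real.exp (d * (Δ / β)) - 1) * ‖r‖ := by
  set w : ℝ := 1 / ((treeStructures p n d).card : ℝ) with hw
  set δ := Real.exp (d * (Δ / β)) - 1 with hδ
  let π : Finset (Split p n) → ℝ := fun ν =>
    (treeSeedLaw p n).real {u | sampleTree t X β r u d = ν}
  have hm : ∀ ν, MeasurableSet {u | sampleTree t X β r u d = ν} := fun ν =>
    measurableSet_sampleTree_eq t X β (z := fun _ => ⇑r) measurable_const measurable_id d ν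
  have hint : (∫ y, leafProj t X (sampleTree t X β r y d) r ∂treeSeedLaw p n) =
      ∑ ν ∈ treeStructures p n d, π ν • leafProj t X ν r := by
    have h1 : ∀ y, leafProj t X (sampleTree t X β r y d) r = ∑ ν ∈ treeStructures p n d,
        Set.indicator {u | sampleTree t X β r u d = ν} (fun _ => leafProj t X ν r) y :=
      fun y => leafProj_sampleTree_eq_sum t X d β r r y
    simp_rw [h1]
    rw [integral_finsetSum]
    · exact Finset.sum_congr rfl fun ν _ => integral_indicator_const _ (hm ν)
    · exact fun ν _ => (integrable_const _).indicator (hm ν)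
  have hπ : ∑ ν ∈ treeStructures p n d, π ν = 1 := by
    have := sum_measureReal_preimage_singleton (μ := treeSeedLaw p n) (treeStructures p n d)
      (f := fun u => sampleTree t X β r u d) fun ν _ => hm ν
    refine Eq.trans this ?_
    rw [show (fun u => sampleTree t X β r u d) ⁻¹' ↑(treeStructures p n d) = Set.univ from
      Set.eq_univ_of_forall fun u => sampleTree_mem_treeStructures t X β r u d]
    exact probReal_univ
  have hle : ∀ ν, π ν - w ≤ δ * w := by
    intro ν
    have := treeSeedLaw_sampleTree_eq_le_card t X hβ (z := r) (Δ := Δ)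
      (fun ν => ⟨score_nonneg t X ν r, (score_le t X ν r).trans hr⟩) d ν
    simp only [π, hδ]
    linarith
  have hδ0 : 0 ≤ δ := by
    have : 0 ≤ Δ := le_trans (by positivity) hr
    have := Real.one_le_exp (show 0 ≤ d * (Δ / β) by positivity)
    linarith
  have hw0 : 0 ≤ w := by positivity
  -- A one-sided bound suffices: both weight systems sum to 1, so the signed terms cancel on
  -- summation and the total variation is at most `2δ`.
  have habs : ∀ ν, |π ν - w| ≤ 2 * δ * w - (π ν - w) := by
    intro ν
    have h1 := hle ν
    have h2 := mul_nonneg hδ0 hw0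
    rw [abs_le]
    constructor <;> linarith
  rw [hint, avgProj_apply, ← Finset.sum_sub_distrib]
  simp_rw [← sub_smul]
  calc _ ≤ ∑ ν ∈ treeStructures p n d, (2 * δ * w - (π ν - w)) * ‖r‖ := by
        refine norm_sum_le_of_le _ fun ν _ => ?_
        rw [norm_smul, Real.norm_eq_abs]
        exact mul_le_mul (habs ν) (norm_leafProj_le t X ν r) (norm_nonneg _)
          ((abs_nonneg _).trans (habs ν))
    _ = _ := by
        rw [← Finset.sum_mul, Finset.sum_sub_distrib, Finset.sum_sub_distrib, hπ,
          ← Finset.mul_sum, sum_weights]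
        ring

instance : IsProbabilityMeasure (seedLaw p n) := by
  unfold seedLaw; infer_instance

/-- One step of boosting with the stationary kernel, acting on residuals. -/
noncomputable def avgStep (ε : ℝ) : EuclideanSpace ℝ (Fin N) →L[ℝ] EuclideanSpace ℝ (Fin N) :=
  ContinuousLinearMap.id ℝ _ - ε • avgProj t X d

theorem avgStep_apply (z : EuclideanSpace ℝ (Fin N)) :
    avgStep t X d ε z = z - ε • avgProj t X d z := rfl

theorem integrable_resid {P : Measure Q} [IsFiniteMeasure P] (h0 : 0 ≤ ε) (h1 : ε ≤ 1)
    {z : Q → EuclideanSpace ℝ (Fin N)} {u : Q → Seeds p n} (hz : Measurable z)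
    (hu : Measurable u) {ρ : ℝ} (hρ : ∀ᵐ q ∂P, ‖z q‖ ≤ ρ) (τ : ℕ) :
    Integrable (fun q => resid t X d β ε (z q) (u q) τ) P :=
  Integrable.of_bound (measurable_resid t X d β ε hz hu τ).aestronglyMeasurable ρ
    (hρ.mono fun _ hq => (norm_resid_le t X d β h0 h1 _ _ τ).trans hq)

/-- The residual at time `τ` does not depend on the seeds of iteration `τ`. Redrawing these and
integrating them first reduces the claim to a single tree with frozen residuals, whose norm is still
at most `‖z‖`. -/
theorem norm_integral_resid_succ_sub_le (hβ : 0 < β) (h0 : 0 ≤ ε) (h1 : ε ≤ 1) {Δ : ℝ}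
    (z : EuclideanSpace ℝ (Fin N)) (hz : (1 / (N : ℝ)) * ‖z‖ ^ 2 ≤ Δ) (τ : ℕ) :
    ‖(∫ u, resid t X d β ε z u (τ + 1) ∂seedLaw p n) -
        avgStep t X d ε (∫ u, resid t X d β ε z u τ ∂seedLaw p n)‖ ≤
      ε * (2 * (Real.exp (d * (Δ / β)) - 1) * ‖z‖) := by
  have hmp := measurePreserving_update (fun _ : ℕ => treeSeedLaw p n) τ
  have hupd : ∀ (u : Seeds p n) y, resid t X d β ε z (Function.update u τ y) (τ + 1) =
      resid t X d β ε z u τ -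
        ε • leafProj t X (sampleTree t X β (resid t X d β ε z u τ) y d)
          (resid t X d β ε z u τ) := by
    intro u y
    simp only [resid]
    rw [resid_congr t X d β ε z τ fun j hj => Function.update_of_ne hj.ne y u,
      Function.update_self]
  have hint : ∀ k, Integrable (fun u => resid t X d β ε z u k) (seedLaw p n) := fun k =>
    integrable_resid t X d h0 h1 measurable_const measurable_id (.of_forall fun _ => le_rfl) k
  have hproj : ∀ u : Seeds p n, Integrable (fun y => leafProj t X
      (sampleTree t X β (resid t X d β ε z u τ) y d) (resid t X d β ε z u τ))
      (treeSeedLaw p n) := fun u =>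
    Integrable.of_bound (measurable_leafProj_sampleTree t X d β measurable_const
      measurable_id).aestronglyMeasurable ‖resid t X d β ε z u τ‖
      (.of_forall fun y => norm_leafProj_le t X _ _)
  have hi : Integrable (fun q : Seeds p n × (ℕ → Split p n → unitInterval) =>
      resid t X d β ε z (Function.update q.1 τ q.2) (τ + 1))
      ((seedLaw p n).prod (treeSeedLaw p n)) := hmp.integrable_comp_of_integrable (hint (τ + 1))
  have hinner : ∀ u : Seeds p n, ∫ y, resid t X d β ε z (Function.update u τ y) (τ + 1)
      ∂treeSeedLaw p n = resid t X d β ε z u τ -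
      ε • ∫ y, leafProj t X (sampleTree t X β (resid t X d β ε z u τ) y d)
          (resid t X d β ε z u τ) ∂treeSeedLaw p n := by
    intro u
    simp only [hupd]
    rw [integral_sub (integrable_const _) (by exact (hproj u).smul ε), integral_const,
      integral_smul, probReal_univ, one_smul]
  have hstep : ∫ u, resid t X d β ε z u (τ + 1) ∂seedLaw p n = ∫ u, ∫ y,
      resid t X d β ε z (Function.update u τ y) (τ + 1) ∂treeSeedLaw p n ∂seedLaw p n := by
    rw [← integral_prod _ hi]
    have hmap : ((seedLaw p n).prod (treeSeedLaw p n)).map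
        (fun q => Function.update q.1 τ q.2) = seedLaw p n := hmp.map_eq
    conv_lhs => rw [← hmap]
    exact integral_map hmp.measurable.aemeasurable
      (measurable_resid t X d β ε measurable_const measurable_id (τ + 1)).aestronglyMeasurable
  have hdiff : (∫ u, resid t X d β ε z u (τ + 1) ∂seedLaw p n) -
        avgStep t X d ε (∫ u, resid t X d β ε z u τ ∂seedLaw p n) =
      ∫ u, -(ε • ((∫ y, leafProj t X (sampleTree t X β (resid t X d β ε z u τ) y d)
          (resid t X d β ε z u τ) ∂treeSeedLaw p n) -
        avgProj t X d (resid t X d β ε z u τ))) ∂seedLaw p n := by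
    rw [hstep, ← ContinuousLinearMap.integral_comp_comm _ (hint τ),
      ← integral_sub hi.integral_prod_left ((avgStep t X d ε).integrable_comp (hint τ))]
    refine integral_congr_ae (.of_forall fun u => ?_)
    simp only [hinner, avgStep_apply, smul_sub]
    abel
  rw [hdiff]
  refine (norm_integral_le_of_norm_le_const (.of_forall fun u => ?_)).trans_eq
    (by rw [probReal_univ, mul_one])
  have hr := norm_resid_le t X d β h0 h1 z u τ
  have hδ : 0 ≤ Real.exp (d * (Δ / β)) - 1 := by
    have : 0 ≤ Δ := le_trans (by positivity) hz
    have := Real.one_le_exp (show 0 ≤ d * (Δ / β) by positivity)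
    linarith
  rw [norm_neg, norm_smul, Real.norm_of_nonneg h0]
  gcongr
  refine (norm_integral_leafProj_sampleTree_sub_le t X d hβ _ (le_trans ?_ hz)).trans ?_
  · gcongr
  · gcongr

/-- The stationary step is a linear contraction, so earlier discrepancies are not amplified and the
bound is linear in `τ`. -/
theorem norm_integral_resid_sub_le (hβ : 0 < β) (h0 : 0 ≤ ε) (h1 : ε ≤ 1) {Δ : ℝ}
    (z : EuclideanSpace ℝ (Fin N)) (hz : (1 / (N : ℝ)) * ‖z‖ ^ 2 ≤ Δ) (τ : ℕ) :
    ‖(∫ u, resid t X d β ε z u τ ∂seedLaw p n) - (avgStep t X d ε ^ τ) z‖ ≤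
      τ * (ε * (2 * (Real.exp (d * (Δ / β)) - 1) * ‖z‖)) := by
  induction τ with
  | zero => simp [resid]
  | succ τ ih =>
    have h := norm_integral_resid_succ_sub_le t X d hβ h0 h1 z hz τ
    set m := fun τ => ∫ u, resid t X d β ε z u τ ∂seedLaw p n
    calc _ = ‖(m (τ + 1) - avgStep t X d ε (m τ)) +
          avgStep t X d ε (m τ - (avgStep t X d ε ^ τ) z)‖ := by
          rw [map_sub, pow_succ', mul_apply_eq_comp]
          congr 1
          abel
      _ ≤ _ := (norm_add_le _ _).trans (add_le_add h
          ((norm_sub_smul_avgProj_le t X d h0 h1 _).trans ih))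
      _ = _ := by push_cast; ring

end Residuals

/-! ### Quadratic forms of sub-Gaussian vectors -/

section QuadraticForm

theorem lintegral_exp_mul_gaussianReal (a : ℝ) :
    ∫⁻ g, ENNReal.ofReal (Real.exp (a * g)) ∂gaussianReal 0 1 =
      ENNReal.ofReal (Real.exp (a ^ 2 / 2)) := by
  rw [← ofReal_integral_eq_lintegral_ofReal (integrable_exp_mul_gaussianReal a)
    (.of_forall fun _ => (Real.exp_pos _).le)]
  have := congrFun (mgf_fun_id_gaussianReal (μ := 0) (v := 1)) a
  rw [mgf] at this
  rw [this]
  simp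

theorem lintegral_exp_sq_gaussianReal_le {x : ℝ} (h0 : 0 ≤ x) (h1 : x ≤ 1 / 2) :
    ∫⁻ g, ENNReal.ofReal (Real.exp (x / 2 * g ^ 2)) ∂gaussianReal 0 1 ≤
      ENNReal.ofReal (Real.exp x) := by
  have hb : 0 < (1 - x) / 2 := by linarith
  rw [gaussianReal_of_var_ne_zero 0 one_ne_zero,
    lintegral_withDensity_eq_lintegral_mul _ (measurable_gaussianPDF 0 1) (by fun_prop)]
  have h : ∀ g : ℝ, (gaussianPDF 0 1 * fun g => ENNReal.ofReal (Real.exp (x / 2 * g ^ 2))) g =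
      ENNReal.ofReal ((√(2 * Real.pi))⁻¹ * Real.exp (-((1 - x) / 2) * g ^ 2)) := by
    intro g
    rw [Pi.mul_apply, gaussianPDF, ← ENNReal.ofReal_mul (gaussianPDFReal_nonneg _ _ _),
      gaussianPDFReal, mul_assoc, ← Real.exp_add]
    congr 2
    · simp
    · congr 1
      simp only [NNReal.coe_one]
      ring
  simp_rw [h]
  rw [← ofReal_integral_eq_lintegral_ofReal ((integrable_exp_neg_mul_sq hb).const_mul _)
    (.of_forall fun _ => by positivity), integral_const_mul, integral_gaussian]
  refine ENNReal.ofReal_le_ofReal ?_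
  have h2 : Real.pi / ((1 - x) / 2) = 2 * Real.pi * (1 / (1 - x)) := by field_simp
  rw [h2, Real.sqrt_mul (show 0 ≤ 2 * Real.pi by positivity), inv_mul_cancel_left₀ (by positivity)]
  refine Real.sqrt_le_iff.2 ⟨(Real.exp_pos _).le, ?_⟩
  rw [div_le_iff₀ (by linarith), ← Real.exp_nat_mul]
  -- The Gaussian integral is `(1 - x)^(-1/2)`. It is at most `e^x` because `(1 - x)(1 + 2x) ≥ 1`
  -- for `0 ≤ x ≤ 1/2`.
  have := Real.add_one_le_exp ((2 : ℕ) * x)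
  push_cast at this ⊢
  nlinarith

theorem lintegral_pi_prod {ι : Type*} [Fintype ι] (γ : Measure ℝ) [IsProbabilityMeasure γ]
    {f : ι → ℝ → ℝ≥0∞} (hf : ∀ i, Measurable (f i)) :
    ∫⁻ g, ∏ i, f i (g i) ∂(Measure.pi fun _ : ι => γ) = ∏ i, ∫⁻ y, f i y ∂γ := by
  have h := lintegral_prod_eq_prod_lintegral_of_indepFun (μ := Measure.pi fun _ : ι => γ)
    Finset.univ (fun i (g : ι → ℝ) => f i (g i))
    (iIndepFun_pi (X := fun i => f i) fun i => (hf i).aemeasurable)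
    (fun i => (hf i).comp (measurable_pi_apply i))
  rw [h]
  refine Finset.prod_congr rfl fun i _ => ?_
  exact (measurePreserving_eval (fun _ : ι => γ) i).lintegral_comp (hf i)

variable {Ω : Type*} [MeasurableSpace Ω] {μ : Measure Ω} {N : ℕ} {w : Fin N → Ω → ℝ} {σ : ℝ≥0}

theorem lintegral_exp_inner_le (hind : iIndepFun w μ)
    (hsub : ∀ i, HasSubgaussianMGF (w i) (σ ^ 2) μ) (v : EuclideanSpace ℝ (Fin N)) :
    ∫⁻ ω, ENNReal.ofReal (Real.exp (inner ℝ v (WithLp.toLp 2 fun i => w i ω))) ∂μ ≤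
      ENNReal.ofReal (Real.exp (σ ^ 2 * ‖v‖ ^ 2 / 2)) := by
  have h : HasSubgaussianMGF (fun ω => ∑ i, v i * w i ω)
      (∑ i, ⟨v i ^ 2, sq_nonneg _⟩ * σ ^ 2) μ := HasSubgaussianMGF.sum_of_iIndepFun
    (hind.comp (fun i y => v i * y) fun i => measurable_const_mul (v i))
    fun i _ => (hsub i).const_mul (v i)
  have hi : ∀ ω, inner ℝ v (WithLp.toLp 2 fun i => w i ω) = 1 * ∑ i, v i * w i ω := by
    intro ω
    simp [PiLp.inner_apply, mul_comm]
  simp_rw [hi]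
  rw [← ofReal_integral_eq_lintegral_ofReal (h.integrable_exp_mul 1)
    (.of_forall fun _ => (Real.exp_pos _).le)]
  refine ENNReal.ofReal_le_ofReal ((h.mgf_le 1).trans_eq ?_)
  congr 1
  rw [EuclideanSpace.norm_sq_eq]
  simp only [Real.norm_eq_abs, sq_abs]
  rw [NNReal.coe_sum]
  change (∑ i, v i ^ 2 * (σ : ℝ) ^ 2) * 1 ^ 2 / 2 = _
  rw [← Finset.sum_mul]
  ring

variable (b : OrthonormalBasis (Fin N) ℝ (EuclideanSpace ℝ (Fin N)))

/-- The coordinates of the noise in the eigenbasis need not be independent. Each `exp` of a square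
is therefore written as a Gaussian average of exponentials of linear forms. After exchanging the
integrals the sub-Gaussian bound applies to one linear form, and what remains is a product of
one-dimensional Gaussian integrals. -/
theorem lintegral_exp_quadratic_le [IsProbabilityMeasure μ] (hσ : 0 < σ)
    (hw : ∀ i, Measurable (w i)) (hind : iIndepFun w μ)
    (hsub : ∀ i, HasSubgaussianMGF (w i) (σ ^ 2) μ) {q : Fin N → ℝ}
    (hq : ∀ k, 0 ≤ q k ∧ q k ≤ 1) :
    ∫⁻ ω, ENNReal.ofReal (Real.exp ((1 / (4 * (σ : ℝ) ^ 2)) *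
      ∑ k, q k * inner ℝ (b k) (WithLp.toLp 2 fun i => w i ω) ^ 2)) ∂μ ≤
      ENNReal.ofReal (Real.exp ((∑ k, q k) / 2)) := by
  set W : Ω → EuclideanSpace ℝ (Fin N) := fun ω => WithLp.toLp 2 fun i => w i ω with hW
  have hWm : Measurable W :=
    (WithLp.measurable_toLp 2 _).comp (measurable_pi_lambda _ hw)
  have hσ' : (0 : ℝ) < σ := hσ
  -- Chosen so that `c k ^ 2 / 2 = q k / (4 σ²)`, matching `E exp(a g) = exp(a² / 2)`.
  set c : Fin N → ℝ := fun k => √(q k / (2 * (σ : ℝ) ^ 2)) with hc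
  have hc2 : ∀ k, c k ^ 2 = q k / (2 * (σ : ℝ) ^ 2) := fun k =>
    Real.sq_sqrt (div_nonneg (hq k).1 (by positivity))
  set γ : Measure (Fin N → ℝ) := Measure.pi fun _ => gaussianReal 0 1
  have h1 : ∀ ω, ENNReal.ofReal (Real.exp ((1 / (4 * (σ : ℝ) ^ 2)) *
      ∑ k, q k * inner ℝ (b k) (W ω) ^ 2)) =
      ∫⁻ g, ENNReal.ofReal (Real.exp (inner ℝ (∑ k, (c k * g k) • b k) (W ω))) ∂γ := by
    intro ω
    have : ∀ g : Fin N → ℝ, ENNReal.ofReal (Real.exp (inner ℝ (∑ k, (c k * g k) • b k) (W ω))) =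
        ∏ k, ENNReal.ofReal (Real.exp ((c k * inner ℝ (b k) (W ω)) * g k)) := by
      intro g
      rw [← ENNReal.ofReal_prod_of_nonneg fun _ _ => (Real.exp_pos _).le, ← Real.exp_sum,
        sum_inner]
      congr 2
      refine Finset.sum_congr rfl fun k _ => ?_
      rw [inner_smul_left, conj_trivial]
      ring
    simp_rw [this]
    rw [lintegral_pi_prod (gaussianReal 0 1)
      (f := fun k y => ENNReal.ofReal (Real.exp ((c k * inner ℝ (b k) (W ω)) * y)))
      fun k => by fun_prop]
    simp_rw [lintegral_exp_mul_gaussianReal]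
    rw [← ENNReal.ofReal_prod_of_nonneg fun _ _ => (Real.exp_pos _).le, ← Real.exp_sum,
      Finset.mul_sum]
    congr 2
    refine Finset.sum_congr rfl fun k _ => ?_
    rw [mul_pow, hc2]
    field_simp
    ring
  have h2 : ∀ g : Fin N → ℝ, ‖∑ k, (c k * g k) • b k‖ ^ 2 = ∑ k, c k ^ 2 * g k ^ 2 := by
    intro g
    rw [← b.sum_sq_norm_inner_right]
    refine Finset.sum_congr rfl fun k _ => ?_
    rw [b.orthonormal.inner_right_fintype, Real.norm_eq_abs, sq_abs, mul_pow]
  rw [lintegral_congr h1, lintegral_lintegral_swap (by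
    refine Measurable.aemeasurable ?_
    have : Measurable fun x : Ω × (Fin N → ℝ) =>
        inner ℝ (∑ k, (c k * x.2 k) • b k) (W x.1) := by
      refine Measurable.inner ?_ (hWm.comp measurable_fst)
      fun_prop
    exact (Real.measurable_exp.comp this).ennreal_ofReal)]
  calc _ ≤ ∫⁻ g, ∏ k, ENNReal.ofReal (Real.exp (q k / 2 / 2 * g k ^ 2)) ∂γ := by
        refine lintegral_mono fun g => (lintegral_exp_inner_le hind hsub _).trans_eq ?_
        rw [← ENNReal.ofReal_prod_of_nonneg fun _ _ => (Real.exp_pos _).le, ← Real.exp_sum, h2,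
          Finset.mul_sum, Finset.sum_div]
        congr 2
        refine Finset.sum_congr rfl fun k _ => ?_
        rw [hc2]
        field_simp
    _ = ∏ k, ∫⁻ y, ENNReal.ofReal (Real.exp (q k / 2 / 2 * y ^ 2)) ∂gaussianReal 0 1 :=
        lintegral_pi_prod (gaussianReal 0 1)
          (f := fun k y => ENNReal.ofReal (Real.exp (q k / 2 / 2 * y ^ 2)))
          fun k => by fun_prop
    _ ≤ ∏ k, ENNReal.ofReal (Real.exp (q k / 2)) :=
        Finset.prod_le_prod' fun k _ => lintegral_exp_sq_gaussianReal_le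
          (by linarith [(hq k).1]) (by linarith [(hq k).2])
    _ = _ := by
        rw [← ENNReal.ofReal_prod_of_nonneg fun _ _ => (Real.exp_pos _).le, ← Real.exp_sum,
          Finset.sum_div]

theorem measure_quadratic_ge_le [IsProbabilityMeasure μ] (hσ : 0 < σ)
    (hw : ∀ i, Measurable (w i)) (hind : iIndepFun w μ)
    (hsub : ∀ i, HasSubgaussianMGF (w i) (σ ^ 2) μ) {q : Fin N → ℝ}
    (hq : ∀ k, 0 ≤ q k ∧ q k ≤ 1) (r : ℝ) :
    μ {ω | r ≤ ∑ k, q k * inner ℝ (b k) (WithLp.toLp 2 fun i => w i ω) ^ 2} ≤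
      ENNReal.ofReal (Real.exp ((∑ k, q k) / 2 - r / (4 * (σ : ℝ) ^ 2))) := by
  have hσ' : (0 : ℝ) < σ := hσ
  have hWm : Measurable fun ω => (WithLp.toLp 2 fun i => w i ω : EuclideanSpace ℝ (Fin N)) :=
    (WithLp.measurable_toLp 2 _).comp (measurable_pi_lambda _ hw)
  have hm : Measurable fun ω => ENNReal.ofReal (Real.exp ((1 / (4 * (σ : ℝ) ^ 2)) *
      ∑ k, q k * inner ℝ (b k) (WithLp.toLp 2 fun i => w i ω) ^ 2)) := by
    refine (Real.measurable_exp.comp (Measurable.const_mul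
      (Finset.measurable_sum _ fun k _ => ?_) _)).ennreal_ofReal
    exact ((measurable_const.inner hWm).pow_const 2).const_mul _
  have h := mul_meas_ge_le_lintegral hm (ENNReal.ofReal (Real.exp (r / (4 * (σ : ℝ) ^ 2))))
    (μ := μ)
  have h' := h.trans (lintegral_exp_quadratic_le b hσ hw hind hsub hq)
  rw [sub_eq_add_neg, Real.exp_add, Real.exp_neg, ← div_eq_mul_inv,
    ENNReal.ofReal_div_of_pos (Real.exp_pos _)]
  rw [ENNReal.le_div_iff_mul_le (Or.inl (by simp [Real.exp_pos])) (Or.inl ENNReal.ofReal_ne_top),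
    mul_comm]
  refine le_trans ?_ h'
  gcongr
  rename_i ω
  intro hω
  refine ENNReal.ofReal_le_ofReal (Real.exp_le_exp.2 ?_)
  rw [div_eq_mul_one_div, mul_comm]
  gcongr

end QuadraticForm

/-! ### Bias and variance of boosting with the stationary kernel -/

section BiasVariance

variable {N p n : ℕ} (t : Fin p → Fin n → ℝ) (X : Fin N → Point p) (d : ℕ) {ε : ℝ}

theorem inner_kernelBasis_avgStep_pow (hN : N ≠ 0) (τ : ℕ) (k : Fin N)
    (z : EuclideanSpace ℝ (Fin N)) :
    inner ℝ (kernelBasis t X d k) ((avgStep t X d ε ^ τ) z) =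
      (1 - ε * empEigenvalue t d X k) ^ τ * inner ℝ (kernelBasis t X d k) z := by
  induction τ with
  | zero => simp
  | succ τ ih =>
    rw [pow_succ', mul_apply_eq_comp, avgStep_apply, inner_sub_right, inner_smul_right,
      inner_kernelBasis_avgProj t X d hN, ih]
    ring

/-- Bernoulli gives `m x ≤ (1 + x)^m`, and `(1 + x)(1 - x) ≤ 1`. -/
theorem mul_one_sub_pow_le_one {x : ℝ} (h0 : 0 ≤ x) (h1 : x ≤ 1) (m : ℕ) :
    m * x * (1 - x) ^ m ≤ 1 := by
  have hB : 1 + m * x ≤ (1 + x) ^ m := one_add_mul_le_pow (by linarith) m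
  have hp : 0 ≤ (1 - x) ^ m := pow_nonneg (by linarith) m
  calc m * x * (1 - x) ^ m ≤ (1 + x) ^ m * (1 - x) ^ m := by gcongr; linarith
    _ = (1 - x ^ 2) ^ m := by rw [← mul_pow]; ring
    _ ≤ 1 := pow_le_one₀ (by nlinarith) (by nlinarith)

theorem eigenvalue_mul_filter_le (hN : N ≠ 0) (h0 : 0 < ε) (h1 : ε ≤ 1) {τ : ℕ} (hτ : 1 ≤ τ)
    (k : Fin N) :
    empEigenvalue t d X k * ((1 - ε * empEigenvalue t d X k) ^ τ) ^ 2 ≤ 1 / (τ * ε) := by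
  have hl0 := empEigenvalue_nonneg t X d hN k
  have hl1 := empEigenvalue_le_one t X d hN k
  have hτ' : (1 : ℝ) ≤ τ := by exact_mod_cast hτ
  set l := empEigenvalue t d X k
  have h := mul_one_sub_pow_le_one (mul_nonneg h0.le hl0)
    (mul_le_one₀ h1 hl0 hl1 : ε * l ≤ 1) (τ * 2)
  rw [pow_mul] at h
  push_cast at h
  rw [le_div_iff₀ (by positivity)]
  have : 0 ≤ (τ : ℝ) * (ε * l) * ((1 - ε * l) ^ τ) ^ 2 := by positivity
  nlinarith

variable {H : Type*} [NormedAddCommGroup H] [InnerProductSpace ℝ H] [CompleteSpace H]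
  [RKHS ℝ H (Point p) ℝ]

/-- By the reproducing property the pairing of `v` with `h(X)` is the inner product in `H` of `h`
with `∑ v i K(X i, ·)`, whose squared norm is `N ⟨v, K v⟩`; then Cauchy–Schwarz. -/
theorem inner_design_sq_le (hN : N ≠ 0)
    (hH : ∀ x y, RKHS.kernel H x y 1 = stationaryKernel t d X x y) (h : H)
    (v : EuclideanSpace ℝ (Fin N)) :
    inner ℝ v (WithLp.toLp 2 fun i => h (X i)) ^ 2 ≤
      ‖h‖ ^ 2 * (N * inner ℝ v (avgProj t X d v)) := by
  have hN' : (N : ℝ) ≠ 0 := by exact_mod_cast hN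
  set g : H := ∑ i, v i • RKHS.kerFun H (X i) (1 : ℝ) with hg
  have h1 : inner ℝ v (WithLp.toLp 2 fun i => h (X i)) = inner ℝ g h := by
    simp [hg, sum_inner, inner_smul_left, PiLp.inner_apply, mul_comm]
  have h2 : ‖g‖ ^ 2 = N * inner ℝ v (avgProj t X d v) := by
    rw [← real_inner_self_eq_norm_sq, hg, sum_inner, PiLp.inner_apply, Finset.mul_sum]
    refine Finset.sum_congr rfl fun i _ => ?_
    rw [avgProj_apply_eq_sum t X d hN, inner_sum]
    simp only [inner_smul_left, inner_smul_right, empKernelMatrix, Matrix.of_apply,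
      RCLike.inner_apply, conj_trivial]
    rw [Finset.sum_mul, Finset.mul_sum]
    refine Finset.sum_congr rfl fun l _ => ?_
    have hk : inner ℝ (RKHS.kerFun H (X i) (1 : ℝ)) (RKHS.kerFun H (X l) (1 : ℝ)) =
        stationaryKernel t d X (X i) (X l) := by
      rw [← hH, RKHS.kerFun_inner, RKHS.kerFun_apply]
      simp
    rw [hk]
    field_simp
  rw [h1, ← h2, mul_comm, ← mul_pow]
  exact sq_le_sq' (by linarith [neg_le_of_abs_le (abs_real_inner_le_norm g h)])
    (real_inner_le_norm g h)

/-- A duality argument that avoids inverting the kernel matrix. With `y = S x` and `v = S y`,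
symmetry gives `⟨v, x⟩ = ‖y‖²`, while `⟨v, K v⟩ ≤ c ‖y‖²` by the spectral bound. Inserting both in
`inner_design_sq_le` and cancelling `‖y‖²` gives the claim. -/
theorem norm_avgStep_pow_design_sq_le (hN : N ≠ 0)
    (hH : ∀ x y, RKHS.kernel H x y 1 = stationaryKernel t d X x y) (h : H) (τ : ℕ) {c : ℝ}
    (hc : ∀ k, empEigenvalue t d X k * ((1 - ε * empEigenvalue t d X k) ^ τ) ^ 2 ≤ c) :
    ‖(avgStep t X d ε ^ τ) (WithLp.toLp 2 fun i => h (X i))‖ ^ 2 ≤ ‖h‖ ^ 2 * (N * c) := by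
  set x : EuclideanSpace ℝ (Fin N) := WithLp.toLp 2 fun i => h (X i) with hx
  set y := (avgStep t X d ε ^ τ) x with hy
  set v := (avgStep t X d ε ^ τ) y with hv
  have key := inner_design_sq_le t X d hN hH h v
  have h1 : inner ℝ v x = ‖y‖ ^ 2 := by
    rw [← (kernelBasis t X d).sum_inner_mul_inner v x, norm_sq_eq_sum_kernelBasis t X d]
    refine Finset.sum_congr rfl fun k _ => ?_
    rw [real_inner_comm, hv, inner_kernelBasis_avgStep_pow t X d hN, hy,
      inner_kernelBasis_avgStep_pow t X d hN]
    ring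
  have h2 : inner ℝ v (avgProj t X d v) ≤ c * ‖y‖ ^ 2 := by
    rw [← (kernelBasis t X d).sum_inner_mul_inner v, norm_sq_eq_sum_kernelBasis t X d y,
      Finset.mul_sum]
    refine Finset.sum_le_sum fun k _ => ?_
    rw [inner_kernelBasis_avgProj t X d hN, real_inner_comm, hv,
      inner_kernelBasis_avgStep_pow t X d hN]
    have := mul_le_mul_of_nonneg_right (hc k) (sq_nonneg (inner ℝ (kernelBasis t X d k) y))
    linarith
  rw [← hx, h1] at key
  have h3 : (‖y‖ ^ 2) ^ 2 ≤ ‖h‖ ^ 2 * (N * c) * ‖y‖ ^ 2 := by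
    refine key.trans ?_
    have : ‖h‖ ^ 2 * (N * inner ℝ v (avgProj t X d v)) ≤ ‖h‖ ^ 2 * (N * (c * ‖y‖ ^ 2)) := by
      gcongr
    linarith
  have hc0 : 0 ≤ c := by
    refine le_trans ?_ (hc ⟨0, Nat.pos_of_ne_zero hN⟩)
    exact mul_nonneg (empEigenvalue_nonneg t X d hN _) (sq_nonneg _)
  by_cases hy0 : ‖y‖ ^ 2 = 0
  · rw [hy0]; positivity
  · have hpos : 0 < ‖y‖ ^ 2 := lt_of_le_of_ne (sq_nonneg _) (Ne.symm hy0)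
    rw [sq (‖y‖ ^ 2)] at h3
    exact le_of_mul_le_mul_right h3 hpos

theorem norm_design_sq_le (hN : N ≠ 0)
    (hH : ∀ x y, RKHS.kernel H x y 1 = stationaryKernel t d X x y) (h : H) :
    ‖(WithLp.toLp 2 fun i => h (X i) : EuclideanSpace ℝ (Fin N))‖ ^ 2 ≤ ‖h‖ ^ 2 * N := by
  simpa using norm_avgStep_pow_design_sq_le t X d (ε := 0) hN hH h 0 (c := 1) (by
    simpa using empEigenvalue_le_one t X d hN)

/-- An upper bound for the squared filter coefficients of `τ` steps of boosting. -/
noncomputable def filterBound (τ : ℕ) (ε : ℝ) (k : Fin N) : ℝ :=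
  min 1 (τ * ε * empEigenvalue t d X k)

theorem filterBound_mem (hN : N ≠ 0) (h0 : 0 ≤ ε) (τ : ℕ) (k : Fin N) :
    0 ≤ filterBound t X d τ ε k ∧ filterBound t X d τ ε k ≤ 1 :=
  ⟨le_min zero_le_one (mul_nonneg (by positivity) (empEigenvalue_nonneg t X d hN k)),
    min_le_left _ _⟩

/-- The filter coefficient `1 - (1 - ελ)^τ` lies in `[0, 1]` and is at most `τελ` by Bernoulli. The
bound uses only the horizon `T`, so it holds for a random `τ` with fixed weights. -/
theorem norm_sub_avgStep_pow_sq_le (hN : N ≠ 0) (h0 : 0 ≤ ε) (h1 : ε ≤ 1) {τ T : ℕ}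
    (hτ : τ ≤ T) (z : EuclideanSpace ℝ (Fin N)) :
    ‖z - (avgStep t X d ε ^ τ) z‖ ^ 2 ≤
      ∑ k, filterBound t X d T ε k * inner ℝ (kernelBasis t X d k) z ^ 2 := by
  rw [norm_sq_eq_sum_kernelBasis t X d]
  refine Finset.sum_le_sum fun k _ => ?_
  rw [inner_sub_right, inner_kernelBasis_avgStep_pow t X d hN]
  have hl0 := empEigenvalue_nonneg t X d hN k
  have hl1 := empEigenvalue_le_one t X d hN k
  unfold filterBound
  set l := empEigenvalue t d X k
  have hx1 : ε * l ≤ 1 := mul_le_one₀ h1 hl0 hl1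
  have hx0 : 0 ≤ ε * l := mul_nonneg h0 hl0
  set s := 1 - (1 - ε * l) ^ τ with hs
  have hs0 : 0 ≤ s := by
    have : (1 - ε * l) ^ τ ≤ 1 := pow_le_one₀ (by linarith) (by linarith)
    linarith
  have hs1 : s ≤ 1 := by
    have : 0 ≤ (1 - ε * l) ^ τ := pow_nonneg (by linarith) τ
    linarith
  have hs2 : s ≤ T * ε * l := by
    have hB := one_add_mul_le_pow (a := -(ε * l)) (by linarith) τ
    have hT : (τ : ℝ) ≤ T := by exact_mod_cast hτ
    have := mul_le_mul_of_nonneg_right hT hx0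
    have e : 1 + -(ε * l) = 1 - ε * l := by ring
    rw [e] at hB
    linarith
  have hle : s ^ 2 ≤ min 1 (T * ε * l) := le_min (pow_le_one₀ hs0 hs1) (by nlinarith)
  calc _ = s ^ 2 * inner ℝ (kernelBasis t X d k) z ^ 2 := by rw [hs]; ring
    _ ≤ _ := by gcongr

end BiasVariance

/-! ### Stopping times and the critical radius -/

section Stopping

variable {N p n : ℕ} (t : Fin p → Fin n → ℝ) (X : Fin N → Point p) (d : ℕ) {σ CH ε : ℝ}

theorem localRademacher_le (hN : N ≠ 0) (ρ : ℝ) :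
    localRademacher t d X ρ ≤ √(2 ^ d / N) := by
  refine Real.sqrt_le_sqrt ?_
  rw [div_eq_mul_one_div (2 ^ d : ℝ), mul_comm (2 ^ d : ℝ)]
  gcongr
  exact (Finset.sum_le_sum fun k _ => min_le_left _ _).trans (sum_empEigenvalue_le t X d hN)

theorem localRademacher_sq (hN : N ≠ 0) (ρ : ℝ) : localRademacher t d X ρ ^ 2 =
    (1 / (N : ℝ)) * ∑ k, min (empEigenvalue t d X k) (ρ ^ 2) :=
  Real.sq_sqrt (mul_nonneg (by positivity) (Finset.sum_nonneg fun k _ =>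
    le_min (empEigenvalue_nonneg t X d hN k) (sq_nonneg _)))

/-- Eigenvalues lie in `[0, 1]`, so `min(λ, ρ²) ≥ λ min(1, ρ²)`, and the trace is at least 1. -/
theorem min_one_sq_div_le_localRademacher_sq (hN : N ≠ 0) (ρ : ℝ) :
    min 1 (ρ ^ 2) / N ≤ localRademacher t d X ρ ^ 2 := by
  rw [localRademacher_sq t X d hN, div_eq_mul_one_div, mul_comm]
  gcongr
  have hm : 0 ≤ min 1 (ρ ^ 2) := le_min zero_le_one (sq_nonneg _)
  calc _ ≤ min 1 (ρ ^ 2) * ∑ k, empEigenvalue t d X k :=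
        le_mul_of_one_le_right hm (one_le_sum_empEigenvalue t X d hN)
    _ ≤ _ := by
        rw [Finset.mul_sum]
        refine Finset.sum_le_sum fun k _ => ?_
        have h0 := empEigenvalue_nonneg t X d hN k
        have h1 := empEigenvalue_le_one t X d hN k
        refine le_min ?_ ?_
        · exact mul_le_of_le_one_left h0 (min_le_left _ _)
        · exact (mul_le_of_le_one_right hm h1).trans (min_le_right _ _)

theorem one_div_sqrt_sq {η : ℝ} (hη : 0 ≤ η) : (1 / √η) ^ 2 = 1 / η := by
  rw [div_pow, one_pow, Real.sq_sqrt hη]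

/-- The set of times past the stopping threshold. -/
def exceedanceSet (σ CH ε : ℝ) : Set ℕ :=
  {τ : ℕ | 1 ≤ τ ∧
    CH ^ 2 / (2 * Real.exp 1 * σ * (τ * ε)) < localRademacher t d X (1 / √(τ * ε))}

/-- The squared complexity is at least `1 / (ηN)` for `η ≥ 1`, while the squared threshold decays
like `1 / η²`. Without this, `sInf ∅ = 0` would give `Tmax` a meaningless value. -/
theorem exceedanceSet_nonempty (hN : N ≠ 0) (hσ : 0 < σ) (hε : 0 < ε) :
    (exceedanceSet t X d σ CH ε).Nonempty := by
  have hN' : (0 : ℝ) < N := by exact_mod_cast Nat.pos_of_ne_zero hN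
  set κ := 2 * Real.exp 1 * σ with hκ
  have hκ0 : 0 < κ := by positivity
  obtain ⟨τ, hτ⟩ := exists_nat_gt (max (1 / ε) (N * CH ^ 4 / κ ^ 2 / ε))
  have h1 : 1 / ε < τ := (le_max_left _ _).trans_lt hτ
  have h2 : N * CH ^ 4 / κ ^ 2 / ε < τ := (le_max_right _ _).trans_lt hτ
  rw [div_lt_iff₀ hε] at h1 h2
  have hτ0 : 0 < τ := by
    rcases Nat.eq_zero_or_pos τ with h | h
    · subst h; simp at h1; linarith
    · exact h
  refine ⟨τ, hτ0, ?_⟩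
  rw [← hκ]
  set η : ℝ := τ * ε with hη
  have hη0 : 0 < η := by linarith
  have h3 := min_one_sq_div_le_localRademacher_sq t X d hN (1 / √η)
  rw [one_div_sqrt_sq hη0.le, min_eq_right (by rw [div_le_one hη0]; exact h1.le)] at h3
  refine lt_of_pow_lt_pow_left₀ 2 (Real.sqrt_nonneg _) (lt_of_lt_of_le ?_ h3)
  rw [div_pow, div_div, div_lt_div_iff₀ (by positivity) (by positivity)]
  rw [div_lt_iff₀ (by positivity)] at h2
  nlinarith

theorem Tmax_eq : Tmax t d X σ CH ε = sInf (exceedanceSet t X d σ CH ε) - 1 := rfl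

theorem Tmax_add_one_mem (hN : N ≠ 0) (hσ : 0 < σ) (hε : 0 < ε) :
    Tmax t d X σ CH ε + 1 ∈ exceedanceSet t X d σ CH ε := by
  have h := Nat.sInf_mem (exceedanceSet_nonempty t X d (CH := CH) hN hσ hε)
  rw [Tmax_eq, Nat.sub_add_cancel h.1]
  exact h

theorem localRademacher_le_of_le_Tmax {τ : ℕ} (h1 : 1 ≤ τ) (hτ : τ ≤ Tmax t d X σ CH ε) :
    localRademacher t d X (1 / √(τ * ε)) ≤ CH ^ 2 / (2 * Real.exp 1 * σ * (τ * ε)) := by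
  have h : τ ∉ exceedanceSet t X d σ CH ε := Nat.notMem_of_lt_sInf (by
    rw [Tmax_eq] at hτ; omega)
  by_contra h'
  exact h ⟨h1, not_le.1 h'⟩

/-- At time `Tmax + 1` the threshold lies below the complexity, which never exceeds `√(2^d / N)`. -/
theorem one_div_Tmax_add_one_lt (hN : N ≠ 0) (hσ : 0 < σ) (hε : 0 < ε) (hCH : 0 < CH) :
    1 / (((Tmax t d X σ CH ε : ℝ) + 1) * ε) <
      2 * Real.exp 1 * σ / CH ^ 2 * √(2 ^ d / N) := by
  have h := (Tmax_add_one_mem t X d (CH := CH) hN hσ hε).2.trans_le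
    (localRademacher_le t X d hN _)
  push_cast at h
  have hκ : 0 < 2 * Real.exp 1 * σ := by positivity
  calc _ = 2 * Real.exp 1 * σ / CH ^ 2 *
        (CH ^ 2 / (2 * Real.exp 1 * σ * (((Tmax t d X σ CH ε : ℝ) + 1) * ε))) := by
        field_simp
    _ < _ := by gcongr

theorem one_div_Tmax_le (hN : N ≠ 0) (hσ : 0 < σ) (hε : 0 < ε) (hCH : 0 < CH)
    (hT : 1 ≤ Tmax t d X σ CH ε) :
    1 / ((Tmax t d X σ CH ε : ℝ) * ε) ≤
      2 * (2 * Real.exp 1 * σ / CH ^ 2 * √(2 ^ d / N)) := by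
  have h := one_div_Tmax_add_one_lt t X d hN hσ hε hCH
  have hT' : (1 : ℝ) ≤ Tmax t d X σ CH ε := by exact_mod_cast hT
  have key : ∀ T : ℝ, 1 ≤ T → 1 / (T * ε) ≤ 2 * (1 / ((T + 1) * ε)) := by
    intro T hT
    rw [mul_one_div, div_le_div_iff₀ (by positivity) (by positivity)]
    nlinarith
  linarith [key _ hT']

/-- A larger `CH` raises the threshold and shrinks the exceedance set. Used to replace the random
`CH` by `A`. -/
theorem Tmax_mono {CH' : ℝ} (hN : N ≠ 0) (hσ : 0 < σ) (hε : 0 < ε) (hCH : 0 ≤ CH)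
    (h : CH ≤ CH') : Tmax t d X σ CH ε ≤ Tmax t d X σ CH' ε := by
  rw [Tmax_eq, Tmax_eq]
  refine Nat.sub_le_sub_right (Nat.sInf_le ?_) 1
  have hm := Nat.sInf_mem (exceedanceSet_nonempty t X d (CH := CH') hN hσ hε)
  refine ⟨hm.1, lt_of_le_of_lt ?_ hm.2⟩
  gcongr

/-- For `η ≥ 1` the lower bound `1 / (ηN)` on the squared complexity must not exceed the squared
threshold, which is of order `1 / η²`. -/
theorem le_of_le_Tmax (hN : N ≠ 0) (hσ : 0 < σ) (hε : 0 < ε) {τ : ℕ} (h1 : 1 ≤ τ)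
    (hτ : τ ≤ Tmax t d X σ CH ε) :
    τ * ε ≤ max 1 (N * (CH ^ 4 / (2 * Real.exp 1 * σ) ^ 2)) := by
  have hN' : (0 : ℝ) < N := by exact_mod_cast Nat.pos_of_ne_zero hN
  have hτ' : (1 : ℝ) ≤ τ := by exact_mod_cast h1
  have h := localRademacher_le_of_le_Tmax t X d h1 hτ
  set κ := 2 * Real.exp 1 * σ with hκ
  have hκ0 : 0 < κ := by positivity
  set η : ℝ := τ * ε with hη
  have hη0 : 0 < η := by positivity
  rcases le_total η 1 with hη1 | hη1
  · exact hη1.trans (le_max_left _ _)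
  refine le_trans ?_ (le_max_right _ _)
  have h3 := min_one_sq_div_le_localRademacher_sq t X d hN (1 / √η)
  rw [one_div_sqrt_sq hη0.le, min_eq_right (by rw [div_le_one hη0]; exact hη1)] at h3
  have h4 := h3.trans (pow_le_pow_left₀ (Real.sqrt_nonneg _) h 2)
  rw [div_pow, div_div, div_le_div_iff₀ (by positivity) (by positivity)] at h4
  rw [mul_div_assoc', le_div_iff₀ (by positivity)]
  have h5 : (η * κ ^ 2) * η ≤ (N * CH ^ 4) * η := by nlinarith
  exact le_of_mul_le_mul_right h5 hη0

/-- Since `min(1, ηλ) = η min(λ, 1/η)`, the sum is `ηN` times the squared complexity at radius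
`1/√η`, which the stopping rule controls. -/
theorem sum_filterBound_le (hN : N ≠ 0) (hσ : 0 < σ) (hε : 0 < ε) {τ : ℕ} (h1 : 1 ≤ τ)
    (hτ : τ ≤ Tmax t d X σ CH ε) :
    ∑ k, filterBound t X d τ ε k ≤
      N * (CH ^ 4 / (2 * Real.exp 1 * σ) ^ 2) * (1 / (τ * ε)) := by
  have hN' : (0 : ℝ) < N := by exact_mod_cast Nat.pos_of_ne_zero hN
  have hτ' : (1 : ℝ) ≤ τ := by exact_mod_cast h1
  have h := localRademacher_le_of_le_Tmax t X d h1 hτ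
  have h2 := pow_le_pow_left₀ (Real.sqrt_nonneg _) h 2
  change localRademacher t d X (1 / √(τ * ε)) ^ 2 ≤ _ at h2
  rw [localRademacher_sq t X d hN, one_div_sqrt_sq (by positivity)] at h2
  set κ := 2 * Real.exp 1 * σ with hκ
  have hκ0 : 0 < κ := by positivity
  unfold filterBound
  set η : ℝ := τ * ε with hη
  have hη0 : 0 < η := by positivity
  have h3 : ∀ k, min 1 (η * empEigenvalue t d X k) =
      η * min (empEigenvalue t d X k) (1 / η) := by
    intro k
    rw [mul_min_of_nonneg _ _ hη0.le, mul_one_div_cancel hη0.ne', min_comm]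
  simp_rw [h3]
  rw [← Finset.mul_sum]
  calc η * ∑ k, min (empEigenvalue t d X k) (1 / η) =
        η * N * (1 / N * ∑ k, min (empEigenvalue t d X k) (1 / η)) := by field_simp
    _ ≤ η * N * (CH ^ 2 / (κ * η)) ^ 2 := by gcongr
    _ = _ := by field_simp

theorem criticalRadius_nonneg : 0 ≤ criticalRadius t d X σ CH :=
  Real.sInf_nonneg fun _ h => h.1.le

theorem criticalRadius_sq_le (hN : N ≠ 0) (hσ : 0 < σ) (hCH : 0 < CH) :
    criticalRadius t d X σ CH ^ 2 ≤ 2 * Real.exp 1 * σ / CH ^ 2 * √(2 ^ d / N) := by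
  have hN' : (0 : ℝ) < N := by exact_mod_cast Nat.pos_of_ne_zero hN
  set r := 2 * Real.exp 1 * σ / CH ^ 2 * √(2 ^ d / N) with hr
  have hr0 : 0 < r := by positivity
  have h : criticalRadius t d X σ CH ≤ √r := by
    refine csInf_le ⟨0, fun _ h => h.1.le⟩ ⟨Real.sqrt_pos.2 hr0, ?_⟩
    refine (localRademacher_le t X d hN _).trans_eq ?_
    rw [Real.sq_sqrt hr0.le, hr]
    field_simp
  calc _ ≤ √r ^ 2 := pow_le_pow_left₀ (criticalRadius_nonneg t X d) h 2
    _ = r := Real.sq_sqrt hr0.le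

end Stopping

/-! ### The mean boosting iterate -/

section MeanBoost

variable {N p n : ℕ} (t : Fin p → Fin n → ℝ) (X : Fin N → Point p) (d : ℕ) {β ε : ℝ}
variable {V : Type*} [MeasurableSpace V] (P : Measure V) [IsProbabilityMeasure P]

theorem norm_integral_prod_resid_sub_le (hβ : 0 < β) (h0 : 0 ≤ ε) (h1 : ε ≤ 1) {Δ ρ : ℝ}
    (hΔ : (1 / (N : ℝ)) * ρ ^ 2 ≤ Δ) {z : V → EuclideanSpace ℝ (Fin N)} (hz : Measurable z)
    (hρ : ∀ᵐ v ∂P, ‖z v‖ ≤ ρ) (τ : ℕ) :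
    ‖(∫ q : V × Seeds p n, resid t X d β ε (z q.1) q.2 τ ∂P.prod (seedLaw p n)) -
        (avgStep t X d ε ^ τ) (∫ v, z v ∂P)‖ ≤
      τ * (ε * (2 * (Real.exp (d * (Δ / β)) - 1) * ρ)) := by
  have hzi : Integrable z P := Integrable.of_bound hz.aestronglyMeasurable ρ hρ
  have hint : Integrable (fun q : V × Seeds p n => resid t X d β ε (z q.1) q.2 τ)
      (P.prod (seedLaw p n)) :=
    integrable_resid t X d h0 h1 (hz.comp measurable_fst) measurable_snd
      (Measure.quasiMeasurePreserving_fst.ae hρ) τ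
  have hΔ0 : 0 ≤ Δ := le_trans (by positivity) hΔ
  have hδ : 0 ≤ Real.exp (d * (Δ / β)) - 1 := by
    have := Real.one_le_exp (show 0 ≤ d * (Δ / β) by positivity)
    linarith
  rw [integral_prod _ hint, ← ContinuousLinearMap.integral_comp_comm _ hzi,
    ← integral_sub hint.integral_prod_left ((avgStep t X d ε ^ τ).integrable_comp hzi)]
  refine (norm_integral_le_of_norm_le_const (hρ.mono fun v hv => ?_)).trans_eq
    (by rw [probReal_univ, mul_one])
  refine (norm_integral_resid_sub_le t X d hβ h0 h1 (z v) (le_trans ?_ hΔ) τ).trans ?_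
  · gcongr
  · gcongr

theorem norm_integral_prod_resid_le (h0 : 0 ≤ ε) (h1 : ε ≤ 1) {ρ : ℝ}
    {z : V → EuclideanSpace ℝ (Fin N)} (hρ : ∀ᵐ v ∂P, ‖z v‖ ≤ ρ) (τ : ℕ) :
    ‖∫ q : V × Seeds p n, resid t X d β ε (z q.1) q.2 τ ∂P.prod (seedLaw p n)‖ ≤ ρ := by
  refine (norm_integral_le_of_norm_le_const (C := ρ) ?_).trans_eq (by rw [probReal_univ, mul_one])
  filter_upwards [Measure.quasiMeasurePreserving_fst.ae hρ] with q hq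
  exact (norm_resid_le t X d β h0 h1 _ _ τ).trans hq

variable {H : Type*} [NormedAddCommGroup H] [InnerProductSpace ℝ H] [RKHS ℝ H (Point p) ℝ]

/-- The values of `h` on the design. -/
def designVec (h : Point p → ℝ) : EuclideanSpace ℝ (Fin N) := WithLp.toLp 2 fun i => h (X i)

/-- Evaluation on the design. -/
noncomputable def designEval (H : Type*) [NormedAddCommGroup H] [InnerProductSpace ℝ H]
    [RKHS ℝ H (Point p) ℝ] : H →L[ℝ] EuclideanSpace ℝ (Fin N) :=
  (PiLp.continuousLinearEquiv 2 ℝ fun _ : Fin N => ℝ).symm.toContinuousLinearMap ∘L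
    ContinuousLinearMap.pi fun i => ContinuousLinearMap.proj (X i) ∘L RKHS.coeCLM ℝ

theorem designEval_apply (h : H) : designEval X H h = designVec X h := rfl

variable [CompleteSpace H]

/-- The error on the design is that of a run with measurable initial residuals. -/
theorem exists_meanBoost_design (h0 : 0 ≤ ε) (h1 : ε ≤ 1) (Y : Fin N → ℝ) {fc : V → H}
    (hfc : Integrable fc P) {ρ : ℝ}
    (hρ : ∀ᵐ v ∂P, ‖WithLp.toLp 2 Y - designVec X (fc v)‖ ≤ ρ) :
    ∃ z : V → EuclideanSpace ℝ (Fin N), Measurable z ∧ (∀ᵐ v ∂P, ‖z v‖ ≤ ρ) ∧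
      ∫ v, z v ∂P = WithLp.toLp 2 Y - designVec X (∫ v, fc v ∂P : H) ∧
      ∀ τ, designVec X (meanBoost P t d X Y β ε (fun v => ⇑(fc v)) τ) = WithLp.toLp 2 Y -
        ∫ q : V × Seeds p n, resid t X d β ε (z q.1) q.2 τ ∂P.prod (seedLaw p n) := by
  have hint : Integrable (fun v => WithLp.toLp 2 Y - designVec X (fc v)) P :=
    (integrable_const _).sub ((designEval X H).integrable_comp hfc)
  -- The warm start is only almost everywhere measurable in `v`; the run is compared with one
  -- started from a measurable version of the residuals.
  obtain ⟨z, hz, hzz⟩ := hint.aestronglyMeasurable.aemeasurable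
  have hρz : ∀ᵐ v ∂P, ‖z v‖ ≤ ρ := by
    filter_upwards [hρ, hzz] with v hv hv'
    rwa [← hv']
  refine ⟨z, hz, hρz, ?_, fun τ => ?_⟩
  · rw [← integral_congr_ae hzz]
    simp only [← designEval_apply]
    rw [integral_sub (integrable_const _) ((designEval X H).integrable_comp hfc), integral_const,
      probReal_univ, one_smul, ContinuousLinearMap.integral_comp_comm _ hfc]
  · have hri : Integrable (fun q : V × Seeds p n => resid t X d β ε (z q.1) q.2 τ)
        (P.prod (seedLaw p n)) :=
      integrable_resid t X d h0 h1 (hz.comp measurable_fst) measurable_snd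
        (Measure.quasiMeasurePreserving_fst.ae hρz) τ
    ext i
    have hproj : ∫ q : V × Seeds p n, resid t X d β ε (z q.1) q.2 τ i ∂P.prod (seedLaw p n) =
        (∫ q : V × Seeds p n, resid t X d β ε (z q.1) q.2 τ ∂P.prod (seedLaw p n)) i :=
      (EuclideanSpace.proj i : EuclideanSpace ℝ (Fin N) →L[ℝ] ℝ).integral_comp_comm hri
    have hpi : Integrable (fun q : V × Seeds p n => resid t X d β ε (z q.1) q.2 τ i)
        (P.prod (seedLaw p n)) :=
      (EuclideanSpace.proj i : EuclideanSpace ℝ (Fin N) →L[ℝ] ℝ).integrable_comp hri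
    refine Eq.trans ?_ (congrArg (Y i - ·) hproj)
    change meanBoost P t d X Y β ε (fun v => ⇑(fc v)) τ (X i) = Y i - _
    unfold meanBoost
    have hcongr : (fun q : V × Seeds p n => boost t d X Y β ε (fc q.1) q.2 τ (X i))
        =ᵐ[P.prod (seedLaw p n)] fun q => Y i - resid t X d β ε (z q.1) q.2 τ i := by
      filter_upwards [Measure.quasiMeasurePreserving_fst.ae hzz] with q hq
      rw [boost_eq_sub_resid, ← hq]
      rfl
    rw [integral_congr_ae hcongr, integral_sub (integrable_const _) hpi, integral_const,
      probReal_univ, one_smul]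

theorem empNormSq_eq (h : Point p → ℝ) : empNormSq X h = (1 / (N : ℝ)) * ‖designVec X h‖ ^ 2 := by
  rw [empNormSq, EuclideanSpace.norm_sq_eq]
  simp [designVec]

theorem norm_add_add_sq_le {E : Type*} [SeminormedAddCommGroup E] (x y z : E) :
    ‖x + y + z‖ ^ 2 ≤ 3 * (‖x‖ ^ 2 + ‖y‖ ^ 2 + ‖z‖ ^ 2) := by
  have h := norm_add₃_le (a := x) (b := y) (c := z)
  calc _ ≤ (‖x‖ + ‖y‖ + ‖z‖) ^ 2 := by gcongr
    _ ≤ _ := by nlinarith [sq_nonneg (‖x‖ - ‖y‖), sq_nonneg (‖y‖ - ‖z‖), sq_nonneg (‖x‖ - ‖z‖)]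

/-- The mean residuals at times 0 and `τ` both have norm at most `C₀ √N`, and `‖h(X)‖ ≤ ‖h‖ √N`.
Valid for every `τ`, including 0. -/
theorem empNormSq_meanBoost_sub_le_crude (hN : N ≠ 0)
    (hH : ∀ x y, RKHS.kernel H x y 1 = stationaryKernel t d X x y) (h0 : 0 ≤ ε) (h1 : ε ≤ 1) (Y : Fin N → ℝ) {fc : V → H}
    (hfc : Integrable fc P) (f₀ : H) {C₀ : ℝ}
    (hρ : ∀ᵐ v ∂P, ‖WithLp.toLp 2 Y - designVec X (fc v)‖ ≤ C₀ * √N) (τ : ℕ) :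
    empNormSq X (fun x => meanBoost P t d X Y β ε (fun v => ⇑(fc v)) τ x - f₀ x) ≤
      (2 * C₀ + ‖(∫ v, fc v ∂P) - f₀‖) ^ 2 := by
  have hN' : (0 : ℝ) < N := by exact_mod_cast Nat.pos_of_ne_zero hN
  obtain ⟨z, hz, hρz, hmean, hb⟩ := exists_meanBoost_design t X d (β := β) P h0 h1 Y hfc hρ
  set h : H := (∫ v, fc v ∂P) - f₀ with hh
  set r := ∫ q : V × Seeds p n, resid t X d β ε (z q.1) q.2 τ ∂P.prod (seedLaw p n)
  have hr : ‖r‖ ≤ C₀ * √N := norm_integral_prod_resid_le t X d P h0 h1 hρz τ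
  have hz' : ‖∫ v, z v ∂P‖ ≤ C₀ * √N :=
    (norm_integral_le_of_norm_le_const hρz).trans_eq (by rw [probReal_univ, mul_one])
  have hhX : ‖designVec X h‖ ≤ ‖h‖ * √N := by
    refine le_of_sq_le_sq ?_ (by positivity)
    rw [mul_pow, Real.sq_sqrt hN'.le]
    exact norm_design_sq_le t X d hN hH h
  have he : designVec X (fun x => meanBoost P t d X Y β ε (fun v => ⇑(fc v)) τ x - f₀ x) =
      (∫ v, z v ∂P) - r + designVec X h := by
    change designVec X (meanBoost P t d X Y β ε (fun v => ⇑(fc v)) τ) - designVec X f₀ = _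
    rw [hb τ, hmean, hh, ← designEval_apply, ← designEval_apply, ← designEval_apply, map_sub]
    abel
  rw [empNormSq_eq, he]
  have hn : ‖(∫ v, z v ∂P) - r + designVec X h‖ ≤ (2 * C₀ + ‖h‖) * √N := by
    have := norm_add_le ((∫ v, z v ∂P) - r) (designVec X h)
    have := norm_sub_le (∫ v, z v ∂P) r
    linarith
  calc _ ≤ (1 / (N : ℝ)) * ((2 * C₀ + ‖h‖) * √N) ^ 2 := by gcongr
    _ = _ := by
      rw [mul_pow, Real.sq_sqrt hN'.le]
      field_simp

/-- The splitting into noise, bias and evolution of the kernel; the factor 3 comes from the square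
of a sum of three terms. The score bound is `C₀²` because `‖z‖² / N ≤ C₀²`. -/
theorem empNormSq_meanBoost_sub_le (hN : N ≠ 0)
    (hH : ∀ x y, RKHS.kernel H x y 1 = stationaryKernel t d X x y) (hβ : 0 < β) (h0 : 0 < ε) (h1 : ε ≤ 1) (Y : Fin N → ℝ)
    {fc : V → H} (hfc : Integrable fc P) (f₀ : H) {C₀ : ℝ}
    (hρ : ∀ᵐ v ∂P, ‖WithLp.toLp 2 Y - designVec X (fc v)‖ ≤ C₀ * √N) {τ T : ℕ}
    (hτ : 1 ≤ τ) (hT : τ ≤ T) :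
    empNormSq X (fun x => meanBoost P t d X Y β ε (fun v => ⇑(fc v)) τ x - f₀ x) ≤
      3 * ((1 / (N : ℝ)) * (∑ k, filterBound t X d T ε k *
          inner ℝ (kernelBasis t X d k) (WithLp.toLp 2 Y - designVec X f₀) ^ 2) +
        ‖(∫ v, fc v ∂P) - f₀‖ ^ 2 * (1 / (τ * ε)) +
        (τ * ε * (2 * (Real.exp (d * (C₀ ^ 2 / β)) - 1) * C₀)) ^ 2) := by
  have hN' : (0 : ℝ) < N := by exact_mod_cast Nat.pos_of_ne_zero hN
  obtain ⟨z, hz, hρz, hmean, hb⟩ := exists_meanBoost_design t X d (β := β) P h0.le h1 Y hfc hρ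
  set h : H := (∫ v, fc v ∂P) - f₀ with hh
  set r := ∫ q : V × Seeds p n, resid t X d β ε (z q.1) q.2 τ ∂P.prod (seedLaw p n)
  set w := WithLp.toLp 2 Y - designVec X f₀ with hw
  set S := avgStep t X d ε ^ τ
  have hr := norm_integral_prod_resid_sub_le t X d P hβ h0.le h1 (Δ := C₀ ^ 2) (by
    rw [mul_pow, Real.sq_sqrt hN'.le]; field_simp; exact le_rfl) hz hρz τ
  have he : designVec X (fun x => meanBoost P t d X Y β ε (fun v => ⇑(fc v)) τ x - f₀ x) =
      (w - S w) + S (designVec X h) + -(r - S (∫ v, z v ∂P)) := by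
    have hzw : ∫ v, z v ∂P = w - designVec X h := by
      rw [hmean, hw, hh, ← designEval_apply, ← designEval_apply, ← designEval_apply, map_sub]
      abel
    change designVec X (meanBoost P t d X Y β ε (fun v => ⇑(fc v)) τ) - designVec X f₀ = _
    have hf : designVec X f₀ = WithLp.toLp 2 Y - w := by rw [hw]; abel
    rw [hb τ, hzw, map_sub S w, hf]
    change WithLp.toLp 2 Y - r - _ = w - S w + S (designVec X h) + -(r - _)
    abel
  rw [empNormSq_eq, he]
  have hvar := norm_sub_avgStep_pow_sq_le t X d hN h0.le h1 hT w
  have hbias := norm_avgStep_pow_design_sq_le t X d hN hH h τ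
    (eigenvalue_mul_filter_le t X d hN h0 h1 hτ)
  have hdrift := pow_le_pow_left₀ (norm_nonneg _) hr 2
  have h3 := norm_add_add_sq_le (w - S w) (S (designVec X h)) (-(r - S (∫ v, z v ∂P)))
  rw [norm_neg] at h3
  change ‖S (designVec X h)‖ ^ 2 ≤ _ at hbias
  calc _ ≤ (1 / (N : ℝ)) * (3 * ((∑ k, filterBound t X d T ε k *
          inner ℝ (kernelBasis t X d k) w ^ 2) + ‖h‖ ^ 2 * (N * (1 / (τ * ε))) +
          (τ * (ε * (2 * (Real.exp (d * (C₀ ^ 2 / β)) - 1) * (C₀ * √N)))) ^ 2)) := by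
        gcongr
        refine h3.trans ?_
        gcongr
    _ = (1 / (N : ℝ)) * (3 * ((∑ k, filterBound t X d T ε k *
          inner ℝ (kernelBasis t X d k) w ^ 2) + ‖h‖ ^ 2 * (N * (1 / (τ * ε))) +
          (τ * ε * (2 * (Real.exp (d * (C₀ ^ 2 / β)) - 1) * C₀)) ^ 2 * √N ^ 2)) := by ring
    _ = _ := by
        rw [Real.sq_sqrt hN'.le]
        field_simp

end MeanBoost

/-! ### The rate at the optimal stopping time -/

section Rate

theorem exp_sub_one_le {x c r : ℝ} (hc : 0 ≤ c) (hr0 : 0 ≤ r) (hr1 : r ≤ 1) (hx : x ≤ c * r) :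
    Real.exp x - 1 ≤ c * Real.exp c * r := by
  have h0 : 0 ≤ c * r := mul_nonneg hc hr0
  have h1 : Real.exp x ≤ Real.exp (c * r) := Real.exp_le_exp.2 hx
  have h2 : Real.exp (c * r) ≤ Real.exp c := Real.exp_le_exp.2 (mul_le_of_le_one_right hc hr1)
  have h3 : 1 - c * r ≤ Real.exp (-(c * r)) := by linarith [Real.add_one_le_exp (-(c * r))]
  have h4 : Real.exp (c * r) - 1 ≤ c * r * Real.exp (c * r) := by
    have h5 := mul_le_mul_of_nonneg_right h3 (Real.exp_pos (c * r)).le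
    rw [← Real.exp_add, neg_add_cancel, Real.exp_zero] at h5
    linarith
  nlinarith [mul_le_mul_of_nonneg_left h2 h0]

/-- The ratio `d⁴ / 2^d` is largest at `d = 6`, where it is 20.25; from 7 on, `((d + 1) / d)⁴ ≤
(8/7)⁴ < 2`. -/
theorem pow_four_le (d : ℕ) : d ^ 4 ≤ 21 * 2 ^ d := by
  rcases le_or_gt d 6 with h | h
  · interval_cases d <;> norm_num
  · induction d, h using Nat.le_induction with
    | base => norm_num
    | succ m hm ih =>
      have hm' : 7 ≤ m := hm
      have h1 : (m + 1) ^ 4 ≤ 2 * m ^ 4 := by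
        have h2 : 7 * (m + 1) ≤ 8 * m := by omega
        have h3 := Nat.pow_le_pow_left h2 4
        rw [mul_pow, mul_pow] at h3
        norm_num at h3
        nlinarith [Nat.zero_le (m ^ 4)]
      calc _ ≤ 2 * m ^ 4 := h1
        _ ≤ 2 * (21 * 2 ^ m) := by gcongr
        _ = _ := by ring

/-- The place where the exponent `5/4` matters: `(N d/β)⁴ ≤ d⁴ / N ≤ 21 · 2^d / N`, and `21 ≤ 5²`.
-/
theorem sq_mul_depth_div_le {N d : ℕ} {β : ℝ} (hN : N ≠ 0)
    (hβ : (N : ℝ) ^ ((5 : ℝ) / 4) ≤ β) :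
    (N * (d / β)) ^ 2 ≤ 5 * √(2 ^ d / N) := by
  have hN' : (0 : ℝ) < N := by exact_mod_cast Nat.pos_of_ne_zero hN
  have hβ0 : 0 < β := (Real.rpow_pos_of_pos hN' _).trans_le hβ
  have h5 : (N : ℝ) ^ 5 ≤ β ^ 4 := by
    calc (N : ℝ) ^ 5 = ((N : ℝ) ^ ((5 : ℝ) / 4)) ^ 4 := by
          rw [← Real.rpow_natCast, ← Real.rpow_natCast, ← Real.rpow_mul hN'.le]
          norm_num
      _ ≤ _ := pow_le_pow_left₀ (by positivity) hβ 4
  have h4 : (d : ℝ) ^ 4 ≤ 21 * 2 ^ d := by exact_mod_cast pow_four_le d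
  refine le_of_sq_le_sq ?_ (by positivity)
  rw [mul_pow 5, Real.sq_sqrt (by positivity)]
  have e : ((N * (d / β)) ^ 2) ^ 2 = (N : ℝ) ^ 4 * (d : ℝ) ^ 4 / β ^ 4 := by
    field_simp
  rw [e, mul_div_assoc', div_le_div_iff₀ (by positivity) hN']
  calc (N : ℝ) ^ 4 * (d : ℝ) ^ 4 * N = (d : ℝ) ^ 4 * (N : ℝ) ^ 5 := by ring
    _ ≤ (5 ^ 2 * 2 ^ d) * β ^ 4 := by
        gcongr
        refine h4.trans ?_
        have : (0 : ℝ) < 2 ^ d := by positivity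
        linarith

/-- The quotient `(1 - q^τ) / (1 - q)` with `q = e^(-x)` is at most `τ`, by Bernoulli. -/
theorem driftBound_le {N : ℕ} {ε M R C₀ : ℝ} (hN : N ≠ 0) (hε : 0 < ε) (hM : 0 < M) (τ : ℕ) :
    driftBound N ε M R C₀ τ ≤
      4 * (τ * ε) ^ 2 / N * (2 * R + C₀ * √N) ^ 2 * (M - 1) ^ 2 := by
  have hN' : (0 : ℝ) < N := by exact_mod_cast Nat.pos_of_ne_zero hN
  set x := ε / (2 * M * N) with hx
  have hx0 : 0 < x := by positivity
  have hy : 0 < 1 - Real.exp (-x) := by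
    have : Real.exp (-x) < 1 := Real.exp_lt_one_iff.2 (by linarith)
    linarith
  have hτ : Real.exp (-(τ * ε / (2 * M * N))) = Real.exp (-x) ^ τ := by
    rw [← Real.exp_nat_mul, hx]
    congr 1
    ring
  have hle : Real.exp (-x) ^ τ ≤ 1 :=
    pow_le_one₀ (Real.exp_pos _).le (Real.exp_le_one_iff.2 (by linarith))
  have hB : 1 - Real.exp (-x) ^ τ ≤ τ * (1 - Real.exp (-x)) := by
    have := one_add_mul_le_pow (a := -(1 - Real.exp (-x)))
      (by linarith [Real.exp_pos (-x)]) τ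
    have e : 1 + -(1 - Real.exp (-x)) = Real.exp (-x) := by ring
    rw [e] at this
    linarith
  unfold driftBound
  rw [hτ]
  calc _ ≤ 4 * ε ^ 2 / N * (2 * R + C₀ * √N) ^ 2 * (M - 1) ^ 2 * (τ : ℝ) ^ 2 := by
        have h0 : 0 ≤ (1 - Real.exp (-x) ^ τ) / (1 - Real.exp (-x)) :=
          div_nonneg (by linarith) hy.le
        have h1 := (div_le_iff₀ hy).2 hB
        gcongr
    _ = _ := by ring

theorem driftBound_nonneg (N : ℕ) (ε M R C₀ : ℝ) (τ : ℕ) : 0 ≤ driftBound N ε M R C₀ τ := by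
  unfold driftBound; positivity

/-- Comparison with the endpoint `Tm`, where the objective is finite; this excludes `T = 0`, where
it is infinite. -/
theorem IsOptimalStop.le_of_one_le {C ε : ℝ} {g : ℕ → ℝ} {Tm T : ℕ} (hC : 0 < C) (hε : 0 < ε)
    (hg : ∀ τ, 0 ≤ g τ) (h : IsOptimalStop C ε g Tm T) (hTm : 1 ≤ Tm) :
    1 ≤ T ∧ C / (T * ε) ≤ C / (Tm * ε) + g Tm := by
  have hval : ∀ τ : ℕ, 1 ≤ τ → stopObjective C ε g τ = ENNReal.ofReal (C / (τ * ε) + g τ) := by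
    intro τ hτ
    have : (1 : ℝ) ≤ τ := by exact_mod_cast hτ
    rw [stopObjective, ← ENNReal.ofReal_div_of_pos (by positivity),
      ENNReal.ofReal_add (by positivity) (hg τ)]
  have hle := h.2 Tm le_rfl
  rw [hval Tm hTm] at hle
  have hT : 1 ≤ T := by
    by_contra hT
    have hT0 : T = 0 := by omega
    have htop : stopObjective C ε g T = ∞ := by
      rw [hT0, stopObjective]
      simp [ENNReal.div_zero, hC]
    rw [htop] at hle
    exact absurd hle (by simp)
  refine ⟨hT, ?_⟩
  rw [hval T hT, ENNReal.ofReal_le_ofReal_iff (add_nonneg (by positivity) (hg Tm))] at hle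
  linarith [hg T]

variable {N p n : ℕ} (t : Fin p → Fin n → ℝ) (X : Fin N → Point p) {d : ℕ}

theorem designNorm_eq (f : Point p → ℝ) : designNorm X f = ‖designVec X f‖ := by
  rw [designNorm, EuclideanSpace.norm_eq]
  simp [designVec]

/-- Comparison with the zero ensemble gives `‖Y - f(X)‖ ≤ ‖Y‖`, hence `‖f(X)‖ ≤ 2‖Y‖`. -/
theorem IsEmpiricalMinimizer.designNorm_le {t : Fin p → Fin n → ℝ} {X : Fin N → Point p}
    {Y : Fin N → ℝ} {f : Point p → ℝ} (hN : N ≠ 0)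
    (h : IsEmpiricalMinimizer t d X Y f) {B : ℝ} (hB : 0 < B) (hY : ∀ i, |Y i| ≤ B) :
    designNorm X f ≤ 2 * B * √N := by
  have hN' : (0 : ℝ) < N := by exact_mod_cast Nat.pos_of_ne_zero hN
  set y : EuclideanSpace ℝ (Fin N) := WithLp.toLp 2 Y with hy
  have hloss : ∀ g : Point p → ℝ, loss X Y g = 1 / (2 * (N : ℝ)) * ‖y - designVec X g‖ ^ 2 := by
    intro g
    rw [loss, EuclideanSpace.norm_sq_eq]
    simp [designVec, hy]
  have h0 := h.2 0 (Submodule.zero_mem _)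
  have hz : designVec X (0 : Point p → ℝ) = 0 := rfl
  rw [hloss, hloss, hz, sub_zero] at h0
  have h1 : ‖y - designVec X f‖ ≤ ‖y‖ :=
    le_of_sq_le_sq (le_of_mul_le_mul_left h0 (by positivity)) (norm_nonneg _)
  have h2 : ‖y‖ ≤ B * √N := by
    refine le_of_sq_le_sq ?_ (by positivity)
    rw [mul_pow, Real.sq_sqrt hN'.le, EuclideanSpace.norm_sq_eq]
    calc ∑ i, ‖y i‖ ^ 2 ≤ ∑ _i : Fin N, B ^ 2 :=
          Finset.sum_le_sum fun i _ => pow_le_pow_left₀ (norm_nonneg _) (hY i) 2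
      _ = _ := by simp [mul_comm]
  rw [designNorm_eq]
  have h3 := norm_sub_le y (y - designVec X f)
  rw [sub_sub_cancel] at h3
  linarith

/-- The constant in the high-probability bound on the noise. -/
noncomputable def noiseConst (σ a A : ℝ) : ℝ :=
  4 * σ ^ 2 * (A ^ 2 / (2 * Real.exp 1 * σ) + 2 * Real.exp 1 * σ / a ^ 2)

/-- The constant in the bound on the horizon, relative to the sample size. -/
noncomputable def horizonConst (σ A : ℝ) : ℝ := 1 + A ^ 4 / (2 * Real.exp 1 * σ) ^ 2

/-- The constant in the bound on the inverse of the optimal stopping time. -/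
noncomputable def biasConst (σ a A B C₀ C : ℝ) : ℝ :=
  (C * (2 * (2 * Real.exp 1 * σ / a ^ 2)) +
    4 * horizonConst σ A ^ 2 * (4 * B + C₀) ^ 2 * (4 * B ^ 2 * Real.exp (4 * B ^ 2)) ^ 2 * 5) / C

/-- The constant in the bound on the effect of the evolving kernel. -/
noncomputable def evolutionConst (σ A C₀ : ℝ) : ℝ :=
  (2 * horizonConst σ A * C₀ * (C₀ ^ 2 * Real.exp (C₀ ^ 2))) ^ 2 * 5

/-- The constant in the final error bound. -/
noncomputable def rateConst (σ a A B C₀ C : ℝ) : ℝ :=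
  (2 * C₀ + A) ^ 2 * (1 + 2 * Real.exp 1 * σ / (4 * a ^ 2)) +
    3 * (noiseConst σ a A + A ^ 2 * biasConst σ a A B C₀ C + evolutionConst σ A C₀)

section Constants

variable {σ a A B C₀ C : ℝ}

theorem noiseConst_nonneg (hσ : 0 < σ) : 0 ≤ noiseConst σ a A := by
  unfold noiseConst; positivity

theorem horizonConst_pos (σ A : ℝ) : 0 < horizonConst σ A := by
  unfold horizonConst; positivity

theorem biasConst_nonneg (hσ : 0 < σ) (hC : 0 < C) : 0 ≤ biasConst σ a A B C₀ C := by
  unfold biasConst; positivity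

theorem evolutionConst_nonneg : 0 ≤ evolutionConst σ A C₀ := by
  unfold evolutionConst; positivity

end Constants

/-- At the endpoint `η = O(N)` and `M - 1 = O(d/β)`, so the drift bound there is of order `(N
d/β)²`, hence of order `√(2^d / N)`, like `1/η` itself. -/
theorem one_div_optimalStop_le {σ a A B C₀ C β ε CH : ℝ} (hσ : 0 < σ) (ha : 0 < a)
    (hB : 0 < B) (hC₀ : 0 < C₀) (hC : 0 < C) (hN : N ≠ 0)
    (hβ : (N : ℝ) ^ ((5 : ℝ) / 4) ≤ β) (hdβ : d ≤ β) (hε : 0 < ε) (haCH : a ≤ CH)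
    (hCHA : CH ≤ A) {R : ℝ} (hR0 : 0 ≤ R) (hR : R ≤ 2 * B * √N) {T : ℕ}
    (hT : IsOptimalStop C ε
      (driftBound N ε (Real.exp (d * R ^ 2 / (N * β))) R C₀) (Tmax t d X σ CH ε) T)
    (hTm : 1 ≤ Tmax t d X σ CH ε) :
    1 ≤ T ∧ 1 / (T * ε) ≤ biasConst σ a A B C₀ C * √(2 ^ d / N) := by
  have hN' : (0 : ℝ) < N := by exact_mod_cast Nat.pos_of_ne_zero hN
  have hN1 : (1 : ℝ) ≤ N := by exact_mod_cast Nat.pos_of_ne_zero hN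
  have hβ0 : 0 < β := (Real.rpow_pos_of_pos hN' _).trans_le hβ
  have hCH : 0 < CH := ha.trans_le haCH
  obtain ⟨hT1, hle⟩ := hT.le_of_one_le hC hε (driftBound_nonneg _ _ _ _ _) hTm
  refine ⟨hT1, ?_⟩
  set S := √(2 ^ d / (N : ℝ)) with hS
  set Tm := Tmax t d X σ CH ε with hTmdef
  set M := Real.exp (d * R ^ 2 / (N * β)) with hM
  have hη0 : 0 ≤ (Tm : ℝ) * ε := by positivity
  have hη : (Tm : ℝ) * ε ≤ N * horizonConst σ A := by
    refine (le_of_le_Tmax t X d hN hσ hε hTm le_rfl).trans (max_le ?_ ?_)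
    · unfold horizonConst
      have : 0 ≤ A ^ 4 / (2 * Real.exp 1 * σ) ^ 2 := by positivity
      nlinarith
    · unfold horizonConst
      gcongr
      have : CH ^ 4 / (2 * Real.exp 1 * σ) ^ 2 ≤ A ^ 4 / (2 * Real.exp 1 * σ) ^ 2 := by gcongr
      linarith
  have hM1 : M - 1 ≤ 4 * B ^ 2 * Real.exp (4 * B ^ 2) * (d / β) := by
    refine exp_sub_one_le (by positivity) (by positivity) ((div_le_one hβ0).2 hdβ) ?_
    calc (d : ℝ) * R ^ 2 / (N * β) ≤ d * (2 * B * √N) ^ 2 / (N * β) := by gcongr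
      _ = _ := by
        rw [mul_pow, Real.sq_sqrt hN'.le]
        field_simp
        norm_num
  have hM0 : 0 ≤ M - 1 := by
    have := Real.one_le_exp (show 0 ≤ d * R ^ 2 / (N * β) by positivity)
    linarith
  have hRC : 2 * R + C₀ * √N ≤ (4 * B + C₀) * √N := by linarith
  have hg : driftBound N ε M R C₀ Tm ≤ 4 * horizonConst σ A ^ 2 * (4 * B + C₀) ^ 2 *
      (4 * B ^ 2 * Real.exp (4 * B ^ 2)) ^ 2 * 5 * S := by
    have hH0 := horizonConst_pos σ A
    calc _ ≤ 4 * (Tm * ε) ^ 2 / N * (2 * R + C₀ * √N) ^ 2 * (M - 1) ^ 2 :=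
          driftBound_le hN hε (Real.exp_pos _) Tm
      _ ≤ 4 * (N * horizonConst σ A) ^ 2 / N * ((4 * B + C₀) * √N) ^ 2 *
          (4 * B ^ 2 * Real.exp (4 * B ^ 2) * (d / β)) ^ 2 := by gcongr
      _ = 4 * horizonConst σ A ^ 2 * (4 * B + C₀) ^ 2 *
          (4 * B ^ 2 * Real.exp (4 * B ^ 2)) ^ 2 * (N * (d / β)) ^ 2 := by
          rw [mul_pow (4 * B + C₀), Real.sq_sqrt hN'.le]
          field_simp
      _ ≤ 4 * horizonConst σ A ^ 2 * (4 * B + C₀) ^ 2 *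
          (4 * B ^ 2 * Real.exp (4 * B ^ 2)) ^ 2 * (5 * S) := by
          gcongr
          exact sq_mul_depth_div_le hN hβ
      _ = _ := by ring
  have hTm' : 1 / ((Tm : ℝ) * ε) ≤ 2 * (2 * Real.exp 1 * σ / a ^ 2 * S) := by
    refine (one_div_Tmax_le t X d hN hσ hε hCH hTm).trans ?_
    gcongr
  have h1 : C * (1 / (T * ε)) ≤ C * (2 * (2 * Real.exp 1 * σ / a ^ 2 * S)) +
      4 * horizonConst σ A ^ 2 * (4 * B + C₀) ^ 2 *
      (4 * B ^ 2 * Real.exp (4 * B ^ 2)) ^ 2 * 5 * S := by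
    have := mul_le_mul_of_nonneg_left hTm' hC.le
    rw [mul_one_div] at this ⊢
    linarith
  rw [← mul_le_mul_iff_right₀ hC]
  refine h1.trans_eq ?_
  unfold biasConst
  field_simp

end Rate

/-! ### Error bound outside a noise event, and the probability of that event -/

section Final

variable {N p n : ℕ} (t : Fin p → Fin n → ℝ) (X : Fin N → Point p) (d : ℕ)

/-- The noise level that must not be exceeded for the error bound to hold. -/
noncomputable def noiseEnergy (A ε : ℝ) (σ : ℝ) (w : EuclideanSpace ℝ (Fin N)) : ℝ :=
  ∑ k, filterBound t X d (Tmax t d X σ A ε) ε k * inner ℝ (kernelBasis t X d k) w ^ 2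

variable {V : Type*} [MeasurableSpace V] (P : Measure V) [IsProbabilityMeasure P]
  {H : Type*} [NormedAddCommGroup H] [InnerProductSpace ℝ H] [CompleteSpace H]
  [RKHS ℝ H (Point p) ℝ]

theorem empNormSq_optimalStop_le {σ a A B C₀ C β ε : ℝ} (hσ : 0 < σ) (ha : 0 < a)
    (hB : 0 < B) (hC₀ : 0 < C₀) (hC : 0 < C) (hN : N ≠ 0)
    (hH : ∀ x y, RKHS.kernel H x y 1 = stationaryKernel t d X x y)
    (hβ : (N : ℝ) ^ ((5 : ℝ) / 4) ≤ β) (hε : 0 < ε) {Y : Fin N → ℝ} (hY : ∀ i, |Y i| ≤ B)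
    {fc : V → H} (hfc : Integrable fc P) (f₀ : H)
    (hρ : ∀ᵐ v ∂P, √(∑ i, (Y i - fc v (X i)) ^ 2) ≤ C₀ * √N)
    (haCH : a ≤ ‖(∫ v, fc v ∂P) - f₀‖) (hCHA : ‖(∫ v, fc v ∂P) - f₀‖ ≤ A)
    {fstar : Point p → ℝ} (hf : IsEmpiricalMinimizer t d X Y fstar)
    (hεM : ε ≤ 1 / (4 * Mβ d X β fstar * N)) {T : ℕ}
    (hT : IsOptimalStop C ε (driftBound N ε (Mβ d X β fstar) (designNorm X fstar) C₀)
      (Tmax t d X σ ‖(∫ v, fc v ∂P) - f₀‖ ε) T)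
    (hnoise : noiseEnergy t X d A ε σ (WithLp.toLp 2 Y - designVec X f₀) <
      N * noiseConst σ a A * √(2 ^ d / N)) :
    empNormSq X (fun x => meanBoost P t d X Y β ε (fun v => ⇑(fc v)) T x - f₀ x) ≤
      rateConst σ a A B C₀ C * √(2 ^ d / N) := by
  have hN' : (0 : ℝ) < N := by exact_mod_cast Nat.pos_of_ne_zero hN
  have hN1 : (1 : ℝ) ≤ N := by exact_mod_cast Nat.pos_of_ne_zero hN
  have hNβ : (N : ℝ) ≤ β := by
    refine le_trans ?_ hβ
    calc (N : ℝ) = (N : ℝ) ^ (1 : ℝ) := (Real.rpow_one _).symm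
      _ ≤ _ := Real.rpow_le_rpow_of_exponent_le hN1 (by norm_num)
  have hβ0 : 0 < β := hN'.trans_le hNβ
  have hρ' : ∀ᵐ v ∂P, ‖WithLp.toLp 2 Y - designVec X (fc v)‖ ≤ C₀ * √N := by
    filter_upwards [hρ] with v hv
    refine le_trans (le_of_eq ?_) hv
    rw [EuclideanSpace.norm_eq]
    simp [designVec]
  have hM1 : 1 ≤ Mβ d X β fstar := Real.one_le_exp (by positivity)
  have hε4 : 4 ≤ 1 / ε := by
    rw [le_div_iff₀ hε]
    rw [le_div_iff₀ (by positivity)] at hεM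
    have h1 : 1 ≤ Mβ d X β fstar * N := by nlinarith
    nlinarith [mul_le_mul_of_nonneg_left h1 hε.le]
  have hε1 : ε ≤ 1 := by
    rw [le_div_iff₀ hε] at hε4
    linarith
  set CH := ‖(∫ v, fc v ∂P) - f₀‖ with hCHdef
  have hCH : 0 < CH := ha.trans_le haCH
  set S := √(2 ^ d / (N : ℝ)) with hS
  have hS0 : 0 ≤ S := Real.sqrt_nonneg _
  have hL := noiseConst_nonneg (a := a) (A := A) hσ
  have hG2 := biasConst_nonneg (a := a) (A := A) (B := B) (C₀ := C₀) hσ hC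
  have hG3 := evolutionConst_nonneg (σ := σ) (A := A) (C₀ := C₀)
  have hκ : 0 < 2 * Real.exp 1 * σ := by positivity
  have hcrude := empNormSq_meanBoost_sub_le_crude t X d (β := β) P hN hH hε.le hε1 Y hfc f₀ hρ' T
  rw [← hCHdef] at hcrude
  have hcrude' := hcrude.trans (pow_le_pow_left₀ (by positivity)
    (by linarith : 2 * C₀ + CH ≤ 2 * C₀ + A) 2)
  have hrest : 0 ≤ 3 * (noiseConst σ a A + A ^ 2 * biasConst σ a A B C₀ C +
      evolutionConst σ A C₀) * S := by positivity
  -- In the first case the crude bound is already of the claimed order. In the second, the summand 1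
  -- forces `S < 1`, hence `d < 2^d < N ≤ β`; the other summand forces `2eσ S / a² < 4 ≤ 1/ε`, hence
  -- `Tmax ≥ 1`.
  by_cases hreg : 1 ≤ (1 + 2 * Real.exp 1 * σ / (4 * a ^ 2)) * S
  · refine hcrude'.trans ?_
    have := mul_le_mul_of_nonneg_left hreg (sq_nonneg (2 * C₀ + A))
    unfold rateConst
    linarith
  push Not at hreg
  have hκa : 0 ≤ 2 * Real.exp 1 * σ / (4 * a ^ 2) * S := by positivity
  have hS1 : S < 1 := by linarith
  have hd : (d : ℝ) ≤ N := by
    rw [hS, Real.sqrt_lt' one_pos, one_pow, div_lt_one hN'] at hS1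
    have : (d : ℝ) < 2 ^ d := by exact_mod_cast Nat.lt_two_pow_self
    linarith
  have hTm : 1 ≤ Tmax t d X σ CH ε := by
    by_contra h0
    have h0' : Tmax t d X σ CH ε = 0 := by omega
    have h1 := one_div_Tmax_add_one_lt t X d hN hσ hε hCH
    rw [h0', Nat.cast_zero, zero_add, one_mul] at h1
    have h2 : 2 * Real.exp 1 * σ / CH ^ 2 * S ≤ 2 * Real.exp 1 * σ / a ^ 2 * S := by gcongr
    have h3 : 2 * Real.exp 1 * σ / (4 * a ^ 2) * S = 2 * Real.exp 1 * σ / a ^ 2 * S / 4 := by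
      field_simp
    linarith
  obtain ⟨hT1, hTη⟩ := one_div_optimalStop_le t X hσ ha hB hC₀ hC hN hβ (hd.trans hNβ) hε haCH
    hCHA (Real.sqrt_nonneg _) (hf.designNorm_le hN hB hY) hT hTm
  -- Passing to the deterministic horizon lets the noise term be controlled by a quadratic form with
  -- fixed weights.
  have hTA : T ≤ Tmax t d X σ A ε := hT.1.trans (Tmax_mono t X d hN hσ hε hCH.le hCHA)
  have hmain := empNormSq_meanBoost_sub_le t X d P hN hH hβ0 hε hε1 Y hfc f₀ hρ' hT1 hTA
  rw [← hCHdef] at hmain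
  have hη : (T : ℝ) * ε ≤ N * horizonConst σ A := by
    refine (le_of_le_Tmax t X d hN hσ hε hT1 hTA).trans (max_le ?_ ?_)
    · unfold horizonConst
      have : 0 ≤ A ^ 4 / (2 * Real.exp 1 * σ) ^ 2 := by positivity
      nlinarith
    · unfold horizonConst
      gcongr
      linarith
  have hδ : Real.exp (d * (C₀ ^ 2 / β)) - 1 ≤ C₀ ^ 2 * Real.exp (C₀ ^ 2) * (d / β) :=
    exp_sub_one_le (by positivity) (by positivity) ((div_le_one hβ0).2 (hd.trans hNβ))
      (le_of_eq (by ring))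
  have hδ0 : 0 ≤ Real.exp (d * (C₀ ^ 2 / β)) - 1 := by
    have := Real.one_le_exp (show 0 ≤ d * (C₀ ^ 2 / β) by positivity)
    linarith
  have hH0 := horizonConst_pos σ A
  have hdrift : (T * ε * (2 * (Real.exp (d * (C₀ ^ 2 / β)) - 1) * C₀)) ^ 2 ≤
      evolutionConst σ A C₀ * S := by
    calc _ ≤ (N * horizonConst σ A * (2 * (C₀ ^ 2 * Real.exp (C₀ ^ 2) * (d / β)) * C₀)) ^ 2 := by
          gcongr
      _ = (2 * horizonConst σ A * C₀ * (C₀ ^ 2 * Real.exp (C₀ ^ 2))) ^ 2 *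
          (N * (d / β)) ^ 2 := by ring
      _ ≤ (2 * horizonConst σ A * C₀ * (C₀ ^ 2 * Real.exp (C₀ ^ 2))) ^ 2 * (5 * S) := by
          gcongr
          exact sq_mul_depth_div_le hN hβ
      _ = _ := by unfold evolutionConst; ring
  have hnoise' : (1 / (N : ℝ)) * noiseEnergy t X d A ε σ (WithLp.toLp 2 Y - designVec X f₀) ≤
      noiseConst σ a A * S := by
    rw [one_div, inv_mul_le_iff₀ hN']
    linarith
  have hbias : CH ^ 2 * (1 / (T * ε)) ≤ A ^ 2 * (biasConst σ a A B C₀ C * S) := by gcongr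
  have h0 : 0 ≤ (2 * C₀ + A) ^ 2 * (1 + 2 * Real.exp 1 * σ / (4 * a ^ 2)) * S := by positivity
  unfold noiseEnergy at hnoise'
  unfold rateConst
  linarith

theorem sum_filterBound_Tmax_le {σ A ε : ℝ} (hσ : 0 < σ) (hA : 0 < A) (hN : N ≠ 0)
    (hε : 0 < ε) :
    ∑ k, filterBound t X d (Tmax t d X σ A ε) ε k ≤
      N * (2 * (A ^ 2 / (2 * Real.exp 1 * σ))) * √(2 ^ d / N) := by
  rcases Nat.eq_zero_or_pos (Tmax t d X σ A ε) with h | h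
  · rw [h]
    simp only [filterBound, Nat.cast_zero, zero_mul]
    simp only [zero_le_one, inf_of_le_right, Finset.sum_const_zero]
    positivity
  · refine (sum_filterBound_le t X d hN hσ hε h le_rfl).trans ?_
    calc _ ≤ N * (A ^ 4 / (2 * Real.exp 1 * σ) ^ 2) *
          (2 * (2 * Real.exp 1 * σ / A ^ 2 * √(2 ^ d / N))) := by
          gcongr
          exact one_div_Tmax_le t X d hN hσ hε hA h
      _ = _ := by field_simp

theorem measure_noiseEnergy_ge_le {σ : ℝ≥0} {a A ε : ℝ} (hσ : 0 < σ) (ha : 0 < a) (hA : 0 < A)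
    (hN : N ≠ 0) (hε : 0 < ε) {Ω : Type*} [MeasurableSpace Ω] {μ : Measure Ω}
    [IsProbabilityMeasure μ] {w : Fin N → Ω → ℝ} (hw : ∀ i, Measurable (w i))
    (hind : iIndepFun w μ) (hsub : ∀ i, HasSubgaussianMGF (w i) (σ ^ 2) μ) :
    μ {ω | N * noiseConst σ a A * √(2 ^ d / N) ≤
      noiseEnergy t X d A ε σ (WithLp.toLp 2 fun i => w i ω)} ≤
      ENNReal.ofReal (Real.exp (-(N * (2 * Real.exp 1 * σ / a ^ 2 * √(2 ^ d / N))))) := by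
  have hσ' : (0 : ℝ) < σ := hσ
  refine (measure_quadratic_ge_le (kernelBasis t X d) hσ hw hind hsub
    (filterBound_mem t X d hN hε.le (Tmax t d X σ A ε)) _).trans ?_
  refine ENNReal.ofReal_le_ofReal (Real.exp_le_exp.2 ?_)
  have h := sum_filterBound_Tmax_le t X d hσ' hA hN hε
  -- The first summand of `noiseConst` cancels half the sum of the weights in the exponential
  -- moment; the second leaves the stated exponent.
  have e : N * noiseConst σ a A * √(2 ^ d / N) / (4 * (σ : ℝ) ^ 2) =
      N * (A ^ 2 / (2 * Real.exp 1 * σ)) * √(2 ^ d / N) +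
        N * (2 * Real.exp 1 * σ / a ^ 2 * √(2 ^ d / N)) := by
    unfold noiseConst
    field_simp
  rw [e]
  linarith

end Final

end GBDT

/-! ### The main theorem -/

theorem corollary3 :
    -- universal constants
    ∃ c₃ > (0 : ℝ), ∃ c₄ > (0 : ℝ),
    -- the fixed problem parameters, on which alone the constant in `O(·)` depends
    ∀ (σ : ℝ≥0) (a A B C₀ C : ℝ), 0 < σ → 0 < a → a ≤ A → 0 < B → 0 < C₀ → 0 < C →
    ∃ K > (0 : ℝ),
    -- sample size, dimension, thresholds per feature, depth, random strength
    ∀ (N p n d : ℕ) (β : ℝ), 1 ≤ N → (N : ℝ) ^ ((5 : ℝ) / 4) ≤ β →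
    ∀ (t : Fin p → Fin n → ℝ)
      -- fixed design, dropped features and the constants that replace them
      (Xfull : Fin N → GBDT.Point p) (I : Finset (Fin p)) (m : GBDT.Point p)
      (X : Fin N → GBDT.Point p), (∀ i, X i = GBDT.dropFeatures I m (Xfull i)) →
    -- the RKHS of the stationary kernel
    ∀ (H : Type*) [NormedAddCommGroup H] [InnerProductSpace ℝ H] [CompleteSpace H]
      [RKHS ℝ H (GBDT.Point p) ℝ],
      (∀ x y, RKHS.kernel H x y 1 = GBDT.stationaryKernel t d X x y) →
    -- data: `Y_i = f₀(X_i) + w_i` with independent centred sub-Gaussian noise, `Y` bounded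
    ∀ (Ω : Type*) [MeasurableSpace Ω] (μ : Measure Ω) [IsProbabilityMeasure μ]
      (f₀ : H) (w : Fin N → Ω → ℝ) (Y : Ω → Fin N → ℝ),
      (∀ i, Measurable (w i)) → iIndepFun w μ → (∀ i, ∫ ω, w i ω ∂μ = 0) →
      (∀ i, HasSubgaussianMGF (w i) (σ ^ 2) μ) →
      (∀ ω i, Y ω i = f₀ (X i) + w i ω) →
      (∀ᵐ ω ∂μ, ∀ i, |Y ω i| ≤ B) →
    -- warm start: the full model, with its training randomness `v`
    ∀ (V : Type*) [MeasurableSpace V] (P : Measure V) [IsProbabilityMeasure P]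
      (fc : Ω → V → H), (∀ᵐ ω ∂μ, Integrable (fc ω) P) →
      (∀ᵐ ω ∂μ, ∀ᵐ v ∂P, Real.sqrt (∑ i, (Y ω i - fc ω v (X i)) ^ 2) ≤ C₀ * Real.sqrt N) →
    ∀ (CH : Ω → ℝ), (∀ ω, CH ω = ‖(∫ v, fc ω v ∂P) - f₀‖) →
      (∀ᵐ ω ∂μ, a ≤ CH ω ∧ CH ω ≤ A) →
    -- empirical minimizer and learning rate
    ∀ (fstar : Ω → GBDT.Point p → ℝ), (∀ ω, GBDT.IsEmpiricalMinimizer t d X (Y ω) (fstar ω)) →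
    ∀ (ε : ℝ), 0 < ε → (∀ᵐ ω ∂μ, ε ≤ 1 / (4 * GBDT.Mβ d X β (fstar ω) * N)) →
    -- the optimal stopping time
    ∀ (Top : Ω → ℕ),
      (∀ ω, GBDT.IsOptimalStop C ε
        (GBDT.driftBound N ε (GBDT.Mβ d X β (fstar ω)) (GBDT.designNorm X (fstar ω)) C₀)
        (GBDT.Tmax t d X σ (CH ω) ε) (Top ω)) →
    μ {ω | ¬ GBDT.empNormSq X (fun x =>
          GBDT.meanBoost P t d X (Y ω) β ε (fun v => ⇑(fc ω v)) (Top ω) x - f₀ x)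
        ≤ K * Real.sqrt (2 ^ d / N)}
      ≤ ENNReal.ofReal c₃ *
        ∫⁻ ω, ENNReal.ofReal
          (Real.exp (-c₄ * N * GBDT.criticalRadius t d X σ (CH ω) ^ 2)) ∂μ := by
  refine ⟨1, one_pos, 1, one_pos, ?_⟩
  intro σ a A B C₀ C hσ ha haA hB hC₀ hC
  have hσ' : (0 : ℝ) < σ := hσ
  -- The maximum with 1 serves only to make the constant visibly positive.
  refine ⟨max 1 (GBDT.rateConst σ a A B C₀ C), lt_max_of_lt_left one_pos, ?_⟩
  intro N p n d β hN1 hβ t Xfull I m X _ H _ _ _ _ hH Ω _ μ _ f₀ w Y hw hind _ hsub hYw hYB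
    V _ P _ fc hfc hρ CH hCH haCH fstar hf ε hε hεM Top hTop
  have hN : N ≠ 0 := by omega
  have hres : ∀ ω, (WithLp.toLp 2 (Y ω) - GBDT.designVec X f₀ : EuclideanSpace ℝ (Fin N)) =
      WithLp.toLp 2 fun i => w i ω := by
    intro ω
    ext i
    change Y ω i - f₀ (X i) = w i ω
    rw [hYw]
    ring
  calc _ ≤ μ {ω | N * GBDT.noiseConst σ a A * √(2 ^ d / N) ≤
        GBDT.noiseEnergy t X d A ε σ (WithLp.toLp 2 fun i => w i ω)} := by
        -- The failure set need not be measurable; it is contained, up to a null set, in the noise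
        -- event.
        refine measure_mono_ae ?_
        filter_upwards [hYB, hfc, hρ, haCH, hεM] with ω hYω hfcω hρω hCHω hεω hbad
        by_contra hgood
        refine hbad ?_
        have hgood' : ¬ N * GBDT.noiseConst σ a A * √(2 ^ d / N) ≤
          GBDT.noiseEnergy t X d A ε σ (WithLp.toLp 2 fun i => w i ω) := hgood
        have hT := hTop ω
        rw [hCH ω] at hT hCHω
        rw [not_le, ← hres ω] at hgood'
        refine (GBDT.empNormSq_optimalStop_le t X d P hσ' ha hB hC₀ hC hN hH hβ hε hYω hfcω f₀
          hρω hCHω.1 hCHω.2 (hf ω) hεω hT hgood').trans ?_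
        gcongr
        exact le_max_right _ _
    _ ≤ ENNReal.ofReal (Real.exp (-(N * (2 * Real.exp 1 * σ / a ^ 2 * √(2 ^ d / N))))) :=
        GBDT.measure_noiseEnergy_ge_le t X d hσ ha (ha.trans_le haA) hN hε hw hind hsub
    _ = ∫⁻ _, ENNReal.ofReal (Real.exp (-(N * (2 * Real.exp 1 * σ / a ^ 2 * √(2 ^ d / N))))) ∂μ :=
        by simp
    _ ≤ _ := by
        rw [ENNReal.ofReal_one, one_mul]
        -- The deterministic exponent is compared pointwise with the random one: `CH ≥ a` gives `ρ̂²
        -- ≤ 2eσ √(2^d / N) / a²`, so no constants beyond `c₃ = c₄ = 1` are needed.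
        refine lintegral_mono_ae ?_
        filter_upwards [haCH] with ω hCHω
        refine ENNReal.ofReal_le_ofReal (Real.exp_le_exp.2 ?_)
        have hpos : 0 < CH ω := ha.trans_le hCHω.1
        have h1 := GBDT.criticalRadius_sq_le t X d hN hσ' hpos
        have h2 : 2 * Real.exp 1 * σ / CH ω ^ 2 * √(2 ^ d / N) ≤
            2 * Real.exp 1 * σ / a ^ 2 * √(2 ^ d / N) := by
          have := hCHω.1
          gcongr
        have h3 := mul_le_mul_of_nonneg_left (h1.trans h2) (Nat.cast_nonneg (α := ℝ) N)
        linarith
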